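/- Let $B:[0,\infty)^2\to[0,\infty)$ be symmetric, $B(x,y)=B(y,x)$, and continuous on $[0,\infty)^2\setminus\{(0,0)\}$. Assume that there are constants $\theta\in(0,1)$, $\delta_*>0$, $\rho_*>0$ and $C_*>0$ such that the support of $B$ (the closure of $\{B\neq0\}$ in $[0,\infty)^2$) is $\Gamma=\Gamma_1\cup\Gamma_2$, where $$\Gamma_1=\{(x,y)\in[0,\infty)^2\setminus[0,\delta_*]^2:\ \theta x\le y\le\theta^{-1}x\},\qquad \Gamma_2=\{(x,y)\in[0,\delta_*]^2:\ |x-y|\le\rho_*\sqrt{xy(x+y)}\},$$ and $$B(x,y)\le B\Big(\tfrac{x+y}2,\tfrac{x+y}2\Big)\le\frac{C_*e^{\frac{x+y}2}}{x+y}\qquad\text{for all }(x,y)\in\Gamma\setminus\{(0,0)\}.$$ Put $b(x,y)=\frac{B(x,y)}{xy}$ and $R(x,y)=b(x,y)(e^{-x}-e^{-y})$, with $b=0$ on the axes. Let $\mathscr M_+([0,\infty))$ be the space of nonnegative finite Borel measures on $[0,\infty)$ with the narrow topology (weak convergence against $C_b([0,\infty))$). For $\mu\in\mathscr M_+([0,\infty))$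 write $M_0(\mu)=\mu([0,\infty))$ and $X_\eta(\mu)=\int_{[0,\infty)}e^{\eta x}\,d\mu(x)\in[0,\infty]$. Let $C_b^1([0,\infty))$ be the space of bounded $C^1$ functions on $[0,\infty)$ with bounded derivative. **Theorem.** Let $u_0\in\mathscr M_+([0,\infty))$ satisfy $X_\eta(u_0)<\infty$ for some $\eta>\frac{1-\theta}2$. Then there exists $u\in C([0,\infty),\mathscr M_+([0,\infty)))$ which is a weak solution of $$\frac{\partial u}{\partial t}(t,x)=u(t,x)\int_0^\infty R(x,y)\,u(t,y)\,dy$$ with initial datum $u_0$, that is: (i) for all $\varphi\in C_b([0,\infty))$, the map $t\mapsto\int_{[0,\infty)}\varphi(x)\,u(t,dx)$ is continuous on $[0,\infty)$, and $\int_{[0,\infty)}\varphi(x)\,u(0,dx)=\int_{[0,\infty)}\varphi(x)\,u_0(dx)$; (ii) for all $\varphi\in C^1_b([0,\infty))$ with $\varphi'(0)=0$, the map $t\mapsto\int_{[0,\infty)}\varphi(x)\,u(t,dx)$ belongs to $W^{1,\infty}_{loc}([0,\infty);\mathbb R)$, and for almost every $t>0$ the double integral below converges absolutely and $$\frac{d}{dt}\int_{[0,\infty)}\varphi(x)\,u(t,dx)=\frac12\iint_{[0,\infty)^2}R(x,y)\big(\varphi(x)-\varphi(y)\big)\,u(t,dx)\,u(t,dy).$$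 Moreover, $M_0(u(t))=M_0(u_0)$ and $X_\eta(u(t))\le X_\eta(u_0)$ for all $t\ge0$. -/

import Mathlib

open MeasureTheory Set Filter Topology
open scoped NNReal ENNReal BoundedContinuousFunction ContDiff

noncomputable section

namespace Compton

/-- The part of the support region that lies outside the square `[0, δ]²`: the cone
`θ x ≤ y ≤ θ⁻¹ x`. -/
def gammaOne (θ δ : ℝ) : Set (ℝ≥0 × ℝ≥0) :=
  {p | ¬((p.1 : ℝ) ≤ δ ∧ (p.2 : ℝ) ≤ δ) ∧
    θ * (p.1 : ℝ) ≤ (p.2 : ℝ) ∧ (p.2 : ℝ) ≤ θ⁻¹ * (p.1 : ℝ)}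

/-- The part of the support region that lies in the square `[0, δ]²`. -/
def gammaTwo (δ ρ : ℝ) : Set (ℝ≥0 × ℝ≥0) :=
  {p | ((p.1 : ℝ) ≤ δ ∧ (p.2 : ℝ) ≤ δ) ∧
    |(p.1 : ℝ) - (p.2 : ℝ)| ≤ ρ * √((p.1 : ℝ) * (p.2 : ℝ) * ((p.1 : ℝ) + (p.2 : ℝ)))}

/-- The support region `Γ = Γ₁ ∪ Γ₂`. -/
def gammaRegion (θ δ ρ : ℝ) : Set (ℝ≥0 × ℝ≥0) :=
  gammaOne θ δ ∪ gammaTwo δ ρ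

/-- The standing assumptions on the truncated redistribution function `B` on `[0, ∞)²`.
The growth bound is imposed away from the origin, where its right-hand side is finite. -/
structure IsKernel (B : ℝ≥0 → ℝ≥0 → ℝ) (θ δ ρ C : ℝ) : Prop where
  theta_pos : 0 < θ
  theta_lt_one : θ < 1
  delta_pos : 0 < δ
  rho_pos : 0 < ρ
  const_pos : 0 < C
  nonneg : ∀ x y, 0 ≤ B x y
  symm : ∀ x y, B x y = B y x
  continuousOn : ContinuousOn (fun p : ℝ≥0 × ℝ≥0 => B p.1 p.2) {((0 : ℝ≥0), (0 : ℝ≥0))}ᶜ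
  support_eq : tsupport (fun p : ℝ≥0 × ℝ≥0 => B p.1 p.2) = gammaRegion θ δ ρ
  le_diag : ∀ x y : ℝ≥0, (x, y) ∈ gammaRegion θ δ ρ → (x, y) ≠ (0, 0) →
    B x y ≤ B ((x + y) / 2) ((x + y) / 2)
  diag_le : ∀ x y : ℝ≥0, (x, y) ∈ gammaRegion θ δ ρ → (x, y) ≠ (0, 0) →
    B ((x + y) / 2) ((x + y) / 2) ≤
      C * Real.exp (((x : ℝ) + (y : ℝ)) / 2) / ((x : ℝ) + (y : ℝ))

/-- `b(x, y) = B(x, y) / (x y)`. Under `IsKernel` the function `B` vanishes on both axes away from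
the origin, and there `b` takes the value `0`. -/
def kernelb (B : ℝ≥0 → ℝ≥0 → ℝ) (x y : ℝ≥0) : ℝ :=
  B x y / ((x : ℝ) * (y : ℝ))

/-- `R(x, y) = b(x, y) (e⁻ˣ - e⁻ʸ)`. -/
def kernelR (B : ℝ≥0 → ℝ≥0 → ℝ) (x y : ℝ≥0) : ℝ :=
  kernelb B x y * (Real.exp (-(x : ℝ)) - Real.exp (-(y : ℝ)))

/-- The exponential moment `X_η(μ) = ∫ e^{η x} dμ(x)`, with values in `[0, ∞]`. -/
def expMoment (η : ℝ) (μ : FiniteMeasure ℝ≥0) : ℝ≥0∞ :=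
  ∫⁻ x : ℝ≥0, ENNReal.ofReal (Real.exp (η * (x : ℝ))) ∂(μ : Measure ℝ≥0)

/-- `φ ∈ C¹_b([0, ∞))`; the derivative at `0` is one-sided, and only the values of `φ` on
`[0, ∞)` matter. -/
structure IsC1b (φ : ℝ → ℝ) : Prop where
  contDiffOn : ContDiffOn ℝ 1 φ (Ici 0)
  bounded : ∃ M : ℝ, ∀ x ∈ Ici (0 : ℝ), |φ x| ≤ M
  deriv_bounded : ∃ M : ℝ, ∀ x ∈ Ici (0 : ℝ), |derivWithin φ (Ici 0) x| ≤ M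

/-- `f ∈ L^∞_loc([0, ∞))`: essentially bounded on `(0, T)` for every `T`. -/
def MemLinftyLoc (f : ℝ → ℝ) : Prop :=
  ∀ T : ℝ, 0 < T → MemLp f ⊤ (volume.restrict (Ioo 0 T))

/-- `g` is the weak derivative of `f` on `(0, ∞)`. -/
def IsWeakDeriv (f g : ℝ → ℝ) : Prop :=
  ∀ ψ : ℝ → ℝ, ContDiff ℝ ∞ ψ → HasCompactSupport ψ → tsupport ψ ⊆ Ioi 0 →
    ∫ t in Ioi (0 : ℝ), f t * deriv ψ t = -∫ t in Ioi (0 : ℝ), g t * ψ t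

/-- `f ∈ W^{1,∞}_loc([0, ∞))`. -/
def MemW1inftyLoc (f : ℝ → ℝ) : Prop :=
  MemLinftyLoc f ∧ ∃ g : ℝ → ℝ, MemLinftyLoc g ∧ IsWeakDeriv f g

/-- The function `t ↦ ∫ φ(x) u(t, x) dx` of real time (only `t ≥ 0` matters). -/
def pairing (u : ℝ≥0 → FiniteMeasure ℝ≥0) (φ : ℝ → ℝ) (t : ℝ) : ℝ :=
  ∫ x : ℝ≥0, φ (x : ℝ) ∂(u t.toNNReal : Measure ℝ≥0)

/-- The integrand `R(x, y) (φ(x) - φ(y))` of the quadratic collision operator in weak form. -/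
def collisionIntegrand (B : ℝ≥0 → ℝ≥0 → ℝ) (φ : ℝ → ℝ) (p : ℝ≥0 × ℝ≥0) : ℝ :=
  kernelR B p.1 p.2 * (φ (p.1 : ℝ) - φ (p.2 : ℝ))

/-- `u` is a weak solution of `∂ₜu(t, x) = u(t, x) ∫ R(x, y) u(t, y) dy` with initial datum
`u₀`. -/
structure IsWeakSolution (B : ℝ≥0 → ℝ≥0 → ℝ) (u₀ : FiniteMeasure ℝ≥0)
    (u : ℝ≥0 → FiniteMeasure ℝ≥0) : Prop where
  continuous_integral : ∀ φ : ℝ≥0 →ᵇ ℝ,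
    Continuous (fun t : ℝ≥0 => ∫ x, φ x ∂(u t : Measure ℝ≥0))
  initial : ∀ φ : ℝ≥0 →ᵇ ℝ,
    ∫ x, φ x ∂(u 0 : Measure ℝ≥0) = ∫ x, φ x ∂(u₀ : Measure ℝ≥0)
  memW1inftyLoc : ∀ φ : ℝ → ℝ, IsC1b φ → derivWithin φ (Ici 0) 0 = 0 →
    MemW1inftyLoc (pairing u φ)
  equation : ∀ φ : ℝ → ℝ, IsC1b φ → derivWithin φ (Ici 0) 0 = 0 →
    ∀ᵐ t ∂(volume.restrict (Ioi (0 : ℝ))),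
      Integrable (collisionIntegrand B φ)
        ((u t.toNNReal : Measure ℝ≥0).prod (u t.toNNReal : Measure ℝ≥0)) ∧
      HasDerivAt (pairing u φ)
        ((1 / 2 : ℝ) * ∫ p : ℝ≥0 × ℝ≥0, collisionIntegrand B φ p
          ∂((u t.toNNReal : Measure ℝ≥0).prod (u t.toNNReal : Measure ℝ≥0))) t

end Compton

end

noncomputable section

namespace Compton

section

/-! ### Test functions -/

/-! Existence comes from compactness, applied to explicit Euler schemes for kernels truncated at
height `n`. Two features of `R` give the a priori bounds: antisymmetry conserves mass, and `R(x, y)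
≥ 0` for `x ≤ y` moves mass towards the origin, so exponential moments cannot grow. All iterates
thus lie in `momentSet`, which is narrowly compact (`isCompact_momentSet`).

The limit passage needs `½ ∬ F d(μ ⊗ μ)` to be continuous on this set, where `F = R(x, y)(φ(x) -
φ(y))`. Near the origin `b` may blow up like `1 / (xy(x + y))`, but on `Γ₂` the product of the two
differences in `F` is at most a constant times `|x - y|² ≤ ρ² xy(x + y)`. So `F` is bounded there,
and `φ'(0) = 0` makes it continuous at the origin. At infinity the cone `Γ₁` gives `F = O(e^{(1 - θ)
max(x, y) / 2})`, negligible against the weight because `η > (1 - θ) / 2`. Hence truncation errors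
are uniformly small relative to the weight, and `F` is approximated in the same sense by bounded
continuous functions (`IsKernel.tendsto_quadForm`).

`exists_limit_curve` is the abstract part: truncation height and step length tend to their limits
together along an ultrafilter, and the limit curve has the required derivative at every `t > 0`. The
admissible test functions separate finite measures (`finiteMeasure_ext_of_isC1b`), so testing
against them controls the narrow topology on the compact set. -/

theorem IsC1b.lipschitz_of_bound {φ : ℝ → ℝ} (hφ : IsC1b φ) {s : Set ℝ} (hs : Convex ℝ s)
    (hs0 : s ⊆ Ici 0) {L : ℝ} (hL : ∀ x ∈ s, |derivWithin φ (Ici 0) x| ≤ L) {x y : ℝ}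
    (hx : x ∈ s) (hy : y ∈ s) : |φ x - φ y| ≤ L * |x - y| := by
  have hd : ∀ z ∈ s, HasDerivWithinAt φ (derivWithin φ (Ici 0) z) s z := fun z hz =>
    ((hφ.contDiffOn.differentiableOn (by norm_num) z (hs0 hz)).hasDerivWithinAt).mono hs0
  simpa using hs.norm_image_sub_le_of_norm_hasDerivWithin_le hd hL hy hx

theorem IsC1b.exists_lipschitz {φ : ℝ → ℝ} (hφ : IsC1b φ) :
    ∃ L, 0 ≤ L ∧ ∀ x y : ℝ, 0 ≤ x → 0 ≤ y → |φ x - φ y| ≤ L * |x - y| := by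
  obtain ⟨L, hL⟩ := hφ.deriv_bounded
  exact ⟨L, (abs_nonneg _).trans (hL 0 self_mem_Ici), fun x y hx hy =>
    hφ.lipschitz_of_bound (convex_Ici 0) Subset.rfl hL hx hy⟩

/-- The estimates use `φ'(0) = 0` only through this bound, which makes the collision integrand
vanish continuously at the origin. -/
theorem IsC1b.exists_small_lipschitz {φ : ℝ → ℝ} (hφ : IsC1b φ)
    (h0 : derivWithin φ (Ici 0) 0 = 0) {ε : ℝ} (hε : 0 < ε) :
    ∃ r, 0 < r ∧ ∀ x y : ℝ, 0 ≤ x → x ≤ r → 0 ≤ y → y ≤ r → |φ x - φ y| ≤ ε * |x - y| := by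
  have hc := hφ.contDiffOn.continuousOn_derivWithin (uniqueDiffOn_Ici 0) (by norm_num) 0
    self_mem_Ici
  obtain ⟨r, hr, hball⟩ := Metric.continuousWithinAt_iff.1 hc ε hε
  refine ⟨r / 2, by positivity, fun x y hx hxr hy hyr => ?_⟩
  refine hφ.lipschitz_of_bound (convex_Icc 0 (r / 2)) Icc_subset_Ici_self (fun z hz => ?_)
    ⟨hx, hxr⟩ ⟨hy, hyr⟩
  have := hball (x := z) hz.1 (by
    rw [Real.dist_eq, sub_zero, abs_of_nonneg hz.1]
    linarith [hz.2])
  rw [h0, Real.dist_eq, sub_zero] at this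
  exact this.le

theorem IsC1b.continuous_coe {φ : ℝ → ℝ} (hφ : IsC1b φ) : Continuous fun x : ℝ≥0 => φ x :=
  hφ.contDiffOn.continuousOn.comp_continuous NNReal.continuous_coe fun x => x.2

/-! ### Elementary properties of the kernel -/

variable {B : ℝ≥0 → ℝ≥0 → ℝ} {θ δ ρ C : ℝ}

/-- The weight `e^{ηx} + e^{ηy}` which dominates the collision integrand. -/
def weight (η : ℝ) (p : ℝ≥0 × ℝ≥0) : ℝ :=
  Real.exp (η * p.1) + Real.exp (η * p.2)

theorem weight_nonneg (η : ℝ) (p : ℝ≥0 × ℝ≥0) : 0 ≤ weight η p := by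
  unfold weight
  positivity

theorem one_le_weight {η : ℝ} (hη : 0 ≤ η) (p : ℝ≥0 × ℝ≥0) : 1 ≤ weight η p := by
  have h1 : 1 ≤ Real.exp (η * p.1) := Real.one_le_exp (by positivity)
  have h2 := Real.exp_pos (η * p.2)
  unfold weight
  linarith

theorem exp_max_le_weight (η : ℝ) (p : ℝ≥0 × ℝ≥0) :
    Real.exp (η * max (p.1 : ℝ) p.2) ≤ weight η p := by
  have h1 := Real.exp_pos (η * p.1)
  have h2 := Real.exp_pos (η * p.2)
  unfold weight
  rcases max_choice (p.1 : ℝ) p.2 with h | h <;> rw [h] <;> linarith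

theorem IsKernel.eq_zero_of_notMem (hB : IsKernel B θ δ ρ C) {x y : ℝ≥0}
    (h : (x, y) ∉ gammaRegion θ δ ρ) : B x y = 0 := by
  rw [← hB.support_eq] at h
  exact image_eq_zero_of_notMem_tsupport (f := fun p : ℝ≥0 × ℝ≥0 => B p.1 p.2) h

theorem IsKernel.kernelb_nonneg (hB : IsKernel B θ δ ρ C) (x y : ℝ≥0) : 0 ≤ kernelb B x y :=
  div_nonneg (hB.nonneg x y) (by positivity)

theorem IsKernel.kernelb_symm (hB : IsKernel B θ δ ρ C) (x y : ℝ≥0) :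
    kernelb B x y = kernelb B y x := by
  unfold kernelb
  rw [hB.symm, mul_comm]

/-- On an axis, the cone inequalities of `Γ₁` force both coordinates to vanish, while the right-hand
side in `Γ₂` is zero and forces `x = y`. -/
theorem IsKernel.notMem_of_axis (hB : IsKernel B θ δ ρ C) {p : ℝ≥0 × ℝ≥0} (hp : p ≠ 0)
    (h : p.1 = 0 ∨ p.2 = 0) : p ∉ gammaRegion θ δ ρ := by
  obtain ⟨x, y⟩ := p
  have hθ := hB.theta_pos
  rintro (⟨-, h1, h2⟩ | ⟨-, h1⟩)
  · refine hp (Prod.ext ?_ ?_)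
    · rcases h with h | h
      · exact h
      · simp only at h
        simp only [h, NNReal.coe_zero] at h1
        have : (x : ℝ) ≤ 0 := by
          by_contra! hx
          exact absurd h1 (not_le.2 (mul_pos hθ hx))
        exact NNReal.coe_eq_zero.1 (le_antisymm this x.2)
    · rcases h with h | h
      · simp only at h
        simp only [h, NNReal.coe_zero, mul_zero] at h2
        exact NNReal.coe_eq_zero.1 (le_antisymm h2 y.2)
      · exact h
  · have h3 : |(x : ℝ) - y| ≤ 0 := by
      rcases h with h | h <;> simp only at h <;> simpa [h] using h1
    have h4 : (x : ℝ) = y := sub_eq_zero.1 (abs_eq_zero.1 (le_antisymm h3 (abs_nonneg _)))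
    have h5 : x = y := NNReal.coe_injective h4
    subst h5
    have h6 : x = 0 := by simpa using h
    exact hp (by rw [h6]; rfl)

/-- An axis point other than the origin lies outside the closed support, so `b` is zero in a whole
neighbourhood and the vanishing denominator does no harm. -/
theorem IsKernel.continuousAt_kernelb (hB : IsKernel B θ δ ρ C) {p : ℝ≥0 × ℝ≥0} (hp : p ≠ 0) :
    ContinuousAt (fun p : ℝ≥0 × ℝ≥0 => kernelb B p.1 p.2) p := by
  by_cases h : p.1 = 0 ∨ p.2 = 0
  · have h1 := hB.notMem_of_axis hp h
    rw [← hB.support_eq, notMem_tsupport_iff_eventuallyEq] at h1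
    refine (continuousAt_const (y := (0 : ℝ))).congr ?_
    filter_upwards [h1] with z hz
    simp only [Pi.zero_apply] at hz
    simp [kernelb, hz]
  · rw [not_or] at h
    have h1 : ContinuousAt (fun p : ℝ≥0 × ℝ≥0 => B p.1 p.2) p :=
      hB.continuousOn.continuousAt (isOpen_compl_singleton.mem_nhds hp)
    refine h1.div (by fun_prop) ?_
    exact mul_ne_zero (NNReal.coe_ne_zero.2 h.1) (NNReal.coe_ne_zero.2 h.2)

theorem IsKernel.measurable_kernelb (hB : IsKernel B θ δ ρ C) :
    Measurable fun p : ℝ≥0 × ℝ≥0 => kernelb B p.1 p.2 :=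
  measurable_of_continuousOn_compl_singleton 0 fun _ hp =>
    (hB.continuousAt_kernelb hp).continuousWithinAt

theorem IsKernel.kernelb_le (hB : IsKernel B θ δ ρ C) {x y : ℝ≥0}
    (h : (x, y) ∈ gammaRegion θ δ ρ) (hx : x ≠ 0) :
    kernelb B x y ≤ C * Real.exp (((x : ℝ) + y) / 2) / ((x : ℝ) + y) / (x * y) := by
  have hxy : (x, y) ≠ (0, 0) := fun h' => hx (Prod.ext_iff.1 h').1
  exact div_le_div_of_nonneg_right ((hB.le_diag x y h hxy).trans (hB.diag_le x y h hxy))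
    (by positivity)

theorem kernelb_zero_left (y : ℝ≥0) : kernelb B 0 y = 0 := by simp [kernelb]

theorem kernelb_zero_right (x : ℝ≥0) : kernelb B x 0 = 0 := by simp [kernelb]

theorem abs_exp_neg_sub_le {x y : ℝ} (hx : 0 ≤ x) (hy : 0 ≤ y) :
    |Real.exp (-x) - Real.exp (-y)| ≤ |x - y| := by
  wlog hxy : x ≤ y generalizing x y
  · rw [abs_sub_comm, abs_sub_comm x]
    exact this hy hx (le_of_not_ge hxy)
  · have h1 : Real.exp (-y) ≤ Real.exp (-x) := Real.exp_le_exp.2 (by linarith)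
    rw [abs_of_nonneg (by linarith), abs_of_nonpos (by linarith)]
    have h2 := Real.add_one_le_exp (-(y - x))
    have h3 : Real.exp (-y) = Real.exp (-x) * Real.exp (-(y - x)) := by
      rw [← Real.exp_add]; ring_nf
    have h4 : Real.exp (-x) ≤ 1 := Real.exp_le_one_iff.2 (by linarith)
    have h5 := Real.exp_pos (-x)
    rw [h3]
    nlinarith

/-- Inside the small square, the collision integrand is controlled by the Lipschitz constant of
the test function. -/
theorem IsKernel.abs_collisionIntegrand_le_near (hB : IsKernel B θ δ ρ C) {φ : ℝ → ℝ} {r L : ℝ}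
    (hr : r ≤ δ) (hL0 : 0 ≤ L)
    (hL : ∀ x y : ℝ, 0 ≤ x → x ≤ r → 0 ≤ y → y ≤ r → |φ x - φ y| ≤ L * |x - y|)
    {p : ℝ≥0 × ℝ≥0} (h1 : (p.1 : ℝ) ≤ r) (h2 : (p.2 : ℝ) ≤ r) :
    |collisionIntegrand B φ p| ≤ C * Real.exp δ * ρ ^ 2 * L := by
  obtain ⟨x, y⟩ := p
  simp only at h1 h2
  have hC := hB.const_pos
  have hpos : 0 ≤ C * Real.exp δ * ρ ^ 2 * L := by positivity
  by_cases hx : x = 0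
  · simpa [collisionIntegrand, kernelR, hx, kernelb_zero_left] using hpos
  by_cases hy : y = 0
  · simpa [collisionIntegrand, kernelR, hy, kernelb_zero_right] using hpos
  by_cases hΓ : (x, y) ∈ gammaRegion θ δ ρ
  swap
  · simpa [collisionIntegrand, kernelR, kernelb, hB.eq_zero_of_notMem hΓ] using hpos
  have hb := hB.kernelb_le hΓ hx
  have hx0 : (0 : ℝ) < x := by exact_mod_cast pos_iff_ne_zero.2 hx
  have hy0 : (0 : ℝ) < y := by exact_mod_cast pos_iff_ne_zero.2 hy
  rcases hΓ with ⟨h, -⟩ | ⟨-, h⟩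
  · exact absurd ⟨h1.trans hr, h2.trans hr⟩ h
  simp only at h
  -- The squared `Γ₂` constraint produces exactly the factor `xy(x + y)` that cancels the singular
  -- denominator of the bound on `b`.
  have hsq : |(x : ℝ) - y| * |(x : ℝ) - y| ≤ ρ ^ 2 * (x * y * (x + y)) := by
    have h3 := mul_self_le_mul_self (abs_nonneg _) h
    refine h3.trans_eq ?_
    have h4 : 0 ≤ (x : ℝ) * y * (x + y) := by positivity
    linear_combination ρ ^ 2 * Real.mul_self_sqrt h4
  have hφ := hL x y x.2 h1 y.2 h2
  have he := abs_exp_neg_sub_le x.2 y.2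
  have hexp : Real.exp (((x : ℝ) + y) / 2) ≤ Real.exp δ := Real.exp_le_exp.2 (by linarith)
  have hb0 := hB.kernelb_nonneg x y
  calc |collisionIntegrand B φ (x, y)|
      = kernelb B x y * (|Real.exp (-(x : ℝ)) - Real.exp (-(y : ℝ))| * |φ x - φ y|) := by
        simp only [collisionIntegrand, kernelR, abs_mul, abs_of_nonneg hb0]
        ring
    _ ≤ kernelb B x y * (|(x : ℝ) - y| * (L * |(x : ℝ) - y|)) :=
        mul_le_mul_of_nonneg_left (mul_le_mul he hφ (abs_nonneg _) (abs_nonneg _)) hb0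
    _ = kernelb B x y * ((|(x : ℝ) - y| * |(x : ℝ) - y|) * L) := by ring
    _ ≤ (C * Real.exp (((x : ℝ) + y) / 2) / ((x : ℝ) + y) / (x * y)) *
        ((ρ ^ 2 * (x * y * (x + y))) * L) := by gcongr
    _ = C * Real.exp (((x : ℝ) + y) / 2) * ρ ^ 2 * L := by field_simp
    _ ≤ C * Real.exp δ * ρ ^ 2 * L := by gcongr

theorem IsKernel.collisionIntegrand_swap (hB : IsKernel B θ δ ρ C) (φ : ℝ → ℝ)
    (p : ℝ≥0 × ℝ≥0) : collisionIntegrand B φ p.swap = collisionIntegrand B φ p := by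
  simp only [collisionIntegrand, kernelR, Prod.fst_swap, Prod.snd_swap, hB.kernelb_symm p.2 p.1]
  ring

/-- Outside the small square, the collision integrand grows at most like
`e^{(1 - θ) max(x, y) / 2}`. -/
theorem IsKernel.abs_collisionIntegrand_le_far (hB : IsKernel B θ δ ρ C) {φ : ℝ → ℝ} {M : ℝ}
    (hM : ∀ x ∈ Ici (0 : ℝ), |φ x| ≤ M) {p : ℝ≥0 × ℝ≥0}
    (hp : ¬((p.1 : ℝ) ≤ δ ∧ (p.2 : ℝ) ≤ δ)) :
    |collisionIntegrand B φ p| ≤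
      C / (δ * (θ * δ * δ)) * (2 * M) * Real.exp ((1 - θ) / 2 * max (p.1 : ℝ) p.2) := by
  wlog hle : p.1 ≤ p.2 generalizing p
  · have h1 := this (p := p.swap) (fun h => hp ⟨h.2, h.1⟩) (le_of_not_ge hle)
    rwa [hB.collisionIntegrand_swap, Prod.fst_swap, Prod.snd_swap, max_comm] at h1
  obtain ⟨x, y⟩ := p
  have hC := hB.const_pos
  have hδ := hB.delta_pos
  have hθ := hB.theta_pos
  have hM0 : 0 ≤ M := (abs_nonneg _).trans (hM 0 self_mem_Ici)
  have hle' : (x : ℝ) ≤ y := hle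
  simp only [max_eq_right hle'] at hp ⊢
  have hpos : 0 ≤ C / (δ * (θ * δ * δ)) * (2 * M) * Real.exp ((1 - θ) / 2 * y) := by positivity
  by_cases hx : x = 0
  · simpa [collisionIntegrand, kernelR, hx, kernelb_zero_left] using hpos
  by_cases hΓ : (x, y) ∈ gammaRegion θ δ ρ
  swap
  · simpa [collisionIntegrand, kernelR, kernelb, hB.eq_zero_of_notMem hΓ] using hpos
  have hb := hB.kernelb_le hΓ hx
  have hx0 : (0 : ℝ) < x := by exact_mod_cast pos_iff_ne_zero.2 hx
  have hyδ : δ < y := by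
    by_contra! h
    exact hp ⟨hle'.trans h, h⟩
  rcases hΓ with ⟨-, -, h⟩ | ⟨h, -⟩
  swap
  · exact absurd h hp
  simp only at h
  have hθy : θ * y ≤ x := by
    have := mul_le_mul_of_nonneg_left h hθ.le
    rwa [mul_inv_cancel_left₀ hθ.ne'] at this
  have hθx : θ * δ ≤ x := (mul_le_mul_of_nonneg_left hyδ.le hθ.le).trans hθy
  have hb0 := hB.kernelb_nonneg x y
  have hden : δ * (θ * δ * δ) ≤ ((x : ℝ) + y) * (x * y) := by
    have : δ ≤ (x : ℝ) + y := by linarith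
    gcongr
  have hdiff : |Real.exp (-(x : ℝ)) - Real.exp (-(y : ℝ))| ≤ Real.exp (-(x : ℝ)) := by
    have h1 : Real.exp (-(y : ℝ)) ≤ Real.exp (-(x : ℝ)) := Real.exp_le_exp.2 (by linarith)
    have h2 := Real.exp_pos (-(y : ℝ))
    rw [abs_of_nonneg (by linarith)]
    linarith
  have hφ : |φ x - φ y| ≤ 2 * M := by
    have h1 := hM x x.2
    have h2 := hM y y.2
    have h3 := abs_sub (φ x) (φ y)
    linarith
  calc |collisionIntegrand B φ (x, y)|
      = kernelb B x y * (|Real.exp (-(x : ℝ)) - Real.exp (-(y : ℝ))| * |φ x - φ y|) := by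
        simp only [collisionIntegrand, kernelR, abs_mul, abs_of_nonneg hb0]
        ring
    _ ≤ (C * Real.exp (((x : ℝ) + y) / 2) / ((x : ℝ) + y) / (x * y)) *
        (Real.exp (-(x : ℝ)) * (2 * M)) := by gcongr
    _ = C / (((x : ℝ) + y) * (x * y)) * (2 * M) *
        (Real.exp (((x : ℝ) + y) / 2) * Real.exp (-(x : ℝ))) := by
        rw [div_div]
        ring
    _ ≤ C / (δ * (θ * δ * δ)) * (2 * M) * Real.exp ((1 - θ) / 2 * y) := by
        rw [← Real.exp_add]
        -- The exponent is `(y - x) / 2`, and `x ≥ θ y` in the cone; this is the origin of the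
        -- threshold `(1 - θ) / 2`.
        have : Real.exp (((x : ℝ) + y) / 2 + -x) ≤ Real.exp ((1 - θ) / 2 * y) :=
          Real.exp_le_exp.2 (by linarith)
        gcongr

theorem IsKernel.continuous_collisionIntegrand (hB : IsKernel B θ δ ρ C) {φ : ℝ → ℝ}
    (hφ : IsC1b φ) (h0 : derivWithin φ (Ici 0) 0 = 0) :
    Continuous (collisionIntegrand B φ) := by
  refine continuous_iff_continuousAt.2 fun p => ?_
  by_cases hp : p = 0
  · subst hp
    have hz : collisionIntegrand B φ 0 = 0 := by simp [collisionIntegrand]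
    rw [ContinuousAt, hz, Metric.tendsto_nhds]
    intro ε hε
    have hC := hB.const_pos
    have hρ := hB.rho_pos
    have hK : 0 < C * Real.exp δ * ρ ^ 2 := by positivity
    obtain ⟨r, hr, hsmall⟩ := hφ.exists_small_lipschitz h0
      (ε := ε / 2 / (C * Real.exp δ * ρ ^ 2)) (by positivity)
    have hr' : 0 < min r δ := lt_min hr hB.delta_pos
    have hn1 : ∀ᶠ p : ℝ≥0 × ℝ≥0 in 𝓝 0, (p.1 : ℝ) < min r δ := by
      have : Continuous fun p : ℝ≥0 × ℝ≥0 => (p.1 : ℝ) := by fun_prop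
      exact this.continuousAt.eventually (gt_mem_nhds (by simpa using hr'))
    have hn2 : ∀ᶠ p : ℝ≥0 × ℝ≥0 in 𝓝 0, (p.2 : ℝ) < min r δ := by
      have : Continuous fun p : ℝ≥0 × ℝ≥0 => (p.2 : ℝ) := by fun_prop
      exact this.continuousAt.eventually (gt_mem_nhds (by simpa using hr'))
    filter_upwards [hn1, hn2] with p hp1 hp2
    have := hB.abs_collisionIntegrand_le_near (φ := φ) (min_le_right r δ)
      (L := ε / 2 / (C * Real.exp δ * ρ ^ 2)) (by positivity)
      (fun x y hx hxr hy hyr => hsmall x y hx (hxr.trans (min_le_left _ _)) hy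
        (hyr.trans (min_le_left _ _))) hp1.le hp2.le
    rw [mul_div_cancel₀ _ hK.ne'] at this
    rw [Real.dist_eq, sub_zero]
    linarith
  · have h1 := hB.continuousAt_kernelb hp
    have h2 : Continuous fun p : ℝ≥0 × ℝ≥0 => φ p.1 - φ p.2 :=
      (hφ.continuous_coe.comp continuous_fst).sub (hφ.continuous_coe.comp continuous_snd)
    have h3 : Continuous fun p : ℝ≥0 × ℝ≥0 =>
        Real.exp (-(p.1 : ℝ)) - Real.exp (-(p.2 : ℝ)) := by fun_prop
    exact (h1.mul h3.continuousAt).mul h2.continuousAt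

theorem IsKernel.eta_pos (hB : IsKernel B θ δ ρ C) {η : ℝ} (hη : (1 - θ) / 2 < η) : 0 < η := by
  linarith [hB.theta_lt_one]

theorem IsKernel.exists_abs_collisionIntegrand_le (hB : IsKernel B θ δ ρ C) {φ : ℝ → ℝ}
    (hφ : IsC1b φ) {η : ℝ} (hη : (1 - θ) / 2 < η) :
    ∃ K, 0 ≤ K ∧ ∀ p, |collisionIntegrand B φ p| ≤ K * weight η p := by
  obtain ⟨M, hM⟩ := hφ.bounded
  obtain ⟨L, hL0, hL⟩ := hφ.exists_lipschitz
  have hM0 : 0 ≤ M := (abs_nonneg _).trans (hM 0 self_mem_Ici)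
  have hC := hB.const_pos
  have hδ := hB.delta_pos
  have hθ := hB.theta_pos
  have hη0 := hB.eta_pos hη
  have hK1 : 0 ≤ C * Real.exp δ * ρ ^ 2 * L := by positivity
  have hK2 : 0 ≤ C / (δ * (θ * δ * δ)) * (2 * M) := by positivity
  refine ⟨C * Real.exp δ * ρ ^ 2 * L + C / (δ * (θ * δ * δ)) * (2 * M), by positivity,
    fun p => ?_⟩
  have hw := one_le_weight hη0.le p
  rw [add_mul]
  by_cases hp : (p.1 : ℝ) ≤ δ ∧ (p.2 : ℝ) ≤ δ
  · have h1 := hB.abs_collisionIntegrand_le_near (φ := φ) le_rfl hL0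
      (fun x y hx _ hy _ => hL x y hx hy) hp.1 hp.2
    nlinarith
  · have h1 := hB.abs_collisionIntegrand_le_far hM hp
    have h2 : Real.exp ((1 - θ) / 2 * max (p.1 : ℝ) p.2) ≤ weight η p := by
      refine le_trans (Real.exp_le_exp.2 ?_) (exp_max_le_weight η p)
      exact mul_le_mul_of_nonneg_right hη.le (le_max_of_le_left p.1.2)
    have h3 := mul_le_mul_of_nonneg_left h2 hK2
    nlinarith

/-- The collision integrand is negligible at infinity with respect to the weight. -/
theorem IsKernel.exists_abs_collisionIntegrand_le_tail (hB : IsKernel B θ δ ρ C) {φ : ℝ → ℝ}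
    (hφ : IsC1b φ) {η : ℝ} (hη : (1 - θ) / 2 < η) {ε : ℝ} (hε : 0 < ε) :
    ∃ A : ℝ≥0, ∀ p : ℝ≥0 × ℝ≥0, p ∉ Icc (0 : ℝ≥0 × ℝ≥0) (A, A) →
      |collisionIntegrand B φ p| ≤ ε * weight η p := by
  obtain ⟨M, hM⟩ := hφ.bounded
  have hM0 : 0 ≤ M := (abs_nonneg _).trans (hM 0 self_mem_Ici)
  have hC := hB.const_pos
  have hδ := hB.delta_pos
  have hθ := hB.theta_pos
  set K := C / (δ * (θ * δ * δ)) * (2 * M) with hK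
  have hK0 : 0 ≤ K := by positivity
  have hlim : Tendsto (fun A : ℝ => K * Real.exp (-((η - (1 - θ) / 2) * A))) atTop (𝓝 0) := by
    have := (Real.tendsto_exp_neg_atTop_nhds_zero.comp
      (tendsto_id.const_mul_atTop (sub_pos.2 hη))).const_mul K
    simpa using this
  -- Besides making the exponential factor small, `A ≥ δ` ensures that points outside the box are
  -- also outside the small square, where the far bound applies.
  obtain ⟨A, hA, hAδ⟩ := ((hlim.eventually (gt_mem_nhds hε)).and (eventually_ge_atTop δ)).exists
  have hA0 : 0 ≤ A := hδ.le.trans hAδ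
  refine ⟨⟨A, hA0⟩, fun p hp => ?_⟩
  have hmax : A < max (p.1 : ℝ) p.2 := by
    by_contra! h
    exact hp ⟨⟨zero_le, zero_le⟩, ⟨(le_max_left _ _).trans h, (le_max_right _ _).trans h⟩⟩
  have h1 := hB.abs_collisionIntegrand_le_far hM (p := p) fun h =>
    absurd (max_le h.1 h.2) (not_le.2 (hAδ.trans_lt hmax))
  have h2 : Real.exp ((1 - θ) / 2 * max (p.1 : ℝ) p.2) ≤
      Real.exp (-((η - (1 - θ) / 2) * A)) * weight η p := by
    refine le_trans ?_ (mul_le_mul_of_nonneg_left (exp_max_le_weight η p) (Real.exp_pos _).le)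
    rw [← Real.exp_add]
    refine Real.exp_le_exp.2 ?_
    have := mul_le_mul_of_nonneg_left hmax.le (sub_pos.2 hη).le
    linarith
  calc |collisionIntegrand B φ p| ≤ K * Real.exp ((1 - θ) / 2 * max (p.1 : ℝ) p.2) := h1
    _ ≤ K * (Real.exp (-((η - (1 - θ) / 2) * A)) * weight η p) := by gcongr
    _ = K * Real.exp (-((η - (1 - θ) / 2) * A)) * weight η p := by ring
    _ ≤ ε * weight η p := mul_le_mul_of_nonneg_right hA.le (weight_nonneg η p)

/-! ### Truncation of the kernel -/

/-- The bounded kernel obtained from `R` by truncating `b` at height `n`. -/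
def truncR (B : ℝ≥0 → ℝ≥0 → ℝ) (n : ℕ) (x y : ℝ≥0) : ℝ :=
  min (kernelb B x y) n * (Real.exp (-(x : ℝ)) - Real.exp (-(y : ℝ)))

/-- The collision integrand for the truncated kernel. -/
def truncIntegrand (B : ℝ≥0 → ℝ≥0 → ℝ) (n : ℕ) (φ : ℝ → ℝ) (p : ℝ≥0 × ℝ≥0) : ℝ :=
  truncR B n p.1 p.2 * (φ p.1 - φ p.2)

theorem IsKernel.truncR_antisymm (hB : IsKernel B θ δ ρ C) (n : ℕ) (x y : ℝ≥0) :
    truncR B n y x = -truncR B n x y := by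
  simp only [truncR, hB.kernelb_symm y x]
  ring

theorem IsKernel.abs_truncR_le (hB : IsKernel B θ δ ρ C) (n : ℕ) (x y : ℝ≥0) :
    |truncR B n x y| ≤ n := by
  have h1 : |Real.exp (-(x : ℝ)) - Real.exp (-(y : ℝ))| ≤ 1 := by
    have hx := Real.exp_pos (-(x : ℝ))
    have hy := Real.exp_pos (-(y : ℝ))
    have hx1 : Real.exp (-(x : ℝ)) ≤ 1 := Real.exp_le_one_iff.2 (by simp)
    have hy1 : Real.exp (-(y : ℝ)) ≤ 1 := Real.exp_le_one_iff.2 (by simp)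
    rw [abs_le]
    constructor <;> linarith
  have h2 : 0 ≤ min (kernelb B x y) n := le_min (hB.kernelb_nonneg x y) n.cast_nonneg
  rw [truncR, abs_mul, abs_of_nonneg h2]
  calc min (kernelb B x y) n * |Real.exp (-(x : ℝ)) - Real.exp (-(y : ℝ))|
      ≤ n * 1 := mul_le_mul (min_le_right _ _) h1 (abs_nonneg _) n.cast_nonneg
    _ = n := mul_one _

theorem IsKernel.measurable_truncR (hB : IsKernel B θ δ ρ C) (n : ℕ) :
    Measurable fun p : ℝ≥0 × ℝ≥0 => truncR B n p.1 p.2 :=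
  (hB.measurable_kernelb.min measurable_const).mul (by fun_prop)

theorem IsKernel.abs_truncIntegrand_le (hB : IsKernel B θ δ ρ C) (n : ℕ) (φ : ℝ → ℝ)
    (p : ℝ≥0 × ℝ≥0) : |truncIntegrand B n φ p| ≤ |collisionIntegrand B φ p| := by
  have h2 : 0 ≤ min (kernelb B p.1 p.2) n := le_min (hB.kernelb_nonneg _ _) n.cast_nonneg
  simp only [truncIntegrand, collisionIntegrand, truncR, kernelR, abs_mul, abs_of_nonneg h2,
    abs_of_nonneg (hB.kernelb_nonneg _ _)]
  gcongr
  exact min_le_left _ _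

theorem IsKernel.abs_truncIntegrand_sub_le (hB : IsKernel B θ δ ρ C) (n : ℕ) (φ : ℝ → ℝ)
    (p : ℝ≥0 × ℝ≥0) :
    |truncIntegrand B n φ p - collisionIntegrand B φ p| ≤ |collisionIntegrand B φ p| := by
  have h1 : 0 ≤ min (kernelb B p.1 p.2) n := le_min (hB.kernelb_nonneg _ _) n.cast_nonneg
  have h2 : min (kernelb B p.1 p.2) n ≤ kernelb B p.1 p.2 := min_le_left _ _
  have h3 : truncIntegrand B n φ p - collisionIntegrand B φ p =
      (min (kernelb B p.1 p.2) n - kernelb B p.1 p.2) *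
      (Real.exp (-(p.1 : ℝ)) - Real.exp (-(p.2 : ℝ))) * (φ p.1 - φ p.2) := by
    simp only [truncIntegrand, collisionIntegrand, truncR, kernelR]
    ring
  rw [h3]
  simp only [collisionIntegrand, kernelR, abs_mul]
  gcongr 1
  gcongr 1
  rw [abs_of_nonpos (by linarith), abs_of_nonneg (by linarith)]
  linarith

/-- The truncation error never exceeds the integrand `|F|`, so it matters only on the part of a
large box where `|F| ≥ ε`. That part is compact and avoids the origin, since `F` vanishes there;
hence `b` is bounded on it and a high truncation changes nothing. -/
theorem IsKernel.exists_truncIntegrand_approx (hB : IsKernel B θ δ ρ C) {φ : ℝ → ℝ}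
    (hφ : IsC1b φ) (h0 : derivWithin φ (Ici 0) 0 = 0) {η : ℝ} (hη : (1 - θ) / 2 < η) {ε : ℝ}
    (hε : 0 < ε) : ∃ n₀ : ℕ, ∀ n ≥ n₀, ∀ p,
      |truncIntegrand B n φ p - collisionIntegrand B φ p| ≤ ε * weight η p := by
  obtain ⟨A, hA⟩ := hB.exists_abs_collisionIntegrand_le_tail hφ hη hε
  have hF := hB.continuous_collisionIntegrand hφ h0
  have hS : IsCompact (Icc (0 : ℝ≥0 × ℝ≥0) (A, A) ∩ {p | ε ≤ |collisionIntegrand B φ p|}) :=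
    isCompact_Icc.inter_right (isClosed_le continuous_const hF.abs)
  have hb : ContinuousOn (fun p : ℝ≥0 × ℝ≥0 => kernelb B p.1 p.2)
      (Icc (0 : ℝ≥0 × ℝ≥0) (A, A) ∩ {p | ε ≤ |collisionIntegrand B φ p|}) := by
    intro p hp
    refine (hB.continuousAt_kernelb ?_).continuousWithinAt
    rintro rfl
    have : ε ≤ |collisionIntegrand B φ 0| := hp.2
    simp [collisionIntegrand] at this
    linarith
  obtain ⟨N, hN⟩ := (hS.image_of_continuousOn hb).bddAbove
  obtain ⟨n₀, hn₀⟩ := exists_nat_ge N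
  refine ⟨n₀, fun n hn p => ?_⟩
  by_cases hp : p ∈ Icc (0 : ℝ≥0 × ℝ≥0) (A, A)
  · by_cases hp' : ε ≤ |collisionIntegrand B φ p|
    · have h1 : kernelb B p.1 p.2 ≤ n :=
        (hN ⟨p, ⟨hp, hp'⟩, rfl⟩).trans (hn₀.trans (by exact_mod_cast hn))
      have h2 : truncIntegrand B n φ p = collisionIntegrand B φ p := by
        simp [truncIntegrand, collisionIntegrand, truncR, kernelR, min_eq_left h1]
      rw [h2, sub_self, abs_zero]
      exact mul_nonneg hε.le (weight_nonneg _ _)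
    · have h1 := hB.abs_truncIntegrand_sub_le n φ p
      have h2 := one_le_weight (hB.eta_pos hη).le p
      nlinarith
  · exact (hB.abs_truncIntegrand_sub_le n φ p).trans (hA p hp)

/-- Clip the integrand at its maximal modulus on a large box: nothing changes inside, and outside
the error is at most the integrand itself, which the weight absorbs. -/
theorem IsKernel.exists_bounded_approx (hB : IsKernel B θ δ ρ C) {φ : ℝ → ℝ}
    (hφ : IsC1b φ) (h0 : derivWithin φ (Ici 0) 0 = 0) {η : ℝ} (hη : (1 - θ) / 2 < η) {ε : ℝ}
    (hε : 0 < ε) : ∃ H : (ℝ≥0 × ℝ≥0) →ᵇ ℝ, ∀ p,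
      |collisionIntegrand B φ p - H p| ≤ ε * weight η p := by
  obtain ⟨A, hA⟩ := hB.exists_abs_collisionIntegrand_le_tail hφ hη hε
  have hF := hB.continuous_collisionIntegrand hφ h0
  obtain ⟨N, hN⟩ := ((isCompact_Icc (a := (0 : ℝ≥0 × ℝ≥0)) (b := (A, A))).image
    hF.abs).bddAbove
  have hN0 : 0 ≤ N := (abs_nonneg _).trans
    (hN ⟨0, ⟨le_rfl, ⟨zero_le, zero_le⟩⟩, rfl⟩)
  refine ⟨BoundedContinuousFunction.ofNormedAddCommGroup
    (fun p => max (-N) (min (collisionIntegrand B φ p) N)) (by fun_prop) N fun p => ?_,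
    fun p => ?_⟩
  · rw [Real.norm_eq_abs, abs_le]
    exact ⟨le_max_left _ _, max_le (by linarith) (min_le_right _ _)⟩
  · simp only [BoundedContinuousFunction.coe_ofNormedAddCommGroup]
    by_cases hp : p ∈ Icc (0 : ℝ≥0 × ℝ≥0) (A, A)
    · have h1 := abs_le.1 (hN ⟨p, hp, rfl⟩)
      rw [min_eq_left h1.2, max_eq_right h1.1, sub_self, abs_zero]
      exact mul_nonneg hε.le (weight_nonneg _ _)
    · refine le_trans ?_ (hA p hp)
      rcases le_total 0 (collisionIntegrand B φ p) with h | h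
      · have h1 : 0 ≤ min (collisionIntegrand B φ p) N := le_min h hN0
        have h2 : min (collisionIntegrand B φ p) N ≤ collisionIntegrand B φ p := min_le_left _ _
        rw [max_eq_right (by linarith), abs_of_nonneg (by linarith), abs_of_nonneg h]
        linarith
      · rw [min_eq_left (h.trans hN0), abs_of_nonpos h, abs_of_nonpos]
        · have := max_le (neg_nonpos.2 hN0) h
          linarith
        · have := le_max_right (-N) (collisionIntegrand B φ p)
          linarith

end

/-! ### Limits of explicit Euler schemes in a compact set -/

/-- In a compact set, convergence can be tested on a separating family of continuous functions. -/
theorem tendsto_of_separating {X ι α : Type*} [TopologicalSpace X] {K : Set X}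
    (hK : IsCompact K) {p : ι → X → ℝ} (hp : ∀ i, Continuous (p i))
    (hsep : ∀ x ∈ K, ∀ y ∈ K, (∀ i, p i x = p i y) → x = y)
    {l : Filter α} {f : α → X} (hf : ∀ᶠ a in l, f a ∈ K) {x : X} (hx : x ∈ K)
    (h : ∀ i, Tendsto (fun a => p i (f a)) l (𝓝 (p i x))) : Tendsto f l (𝓝 x) := by
  refine hK.tendsto_nhds_of_unique_mapClusterPt hf fun y hy hcl => hsep y hy x hx fun i => ?_
  have h1 : MapClusterPt (p i y) l (fun a => p i (f a)) :=
    hcl.continuousAt_comp (hp i).continuousAt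
  have h2 : ClusterPt (p i y) (𝓝 (p i x)) := ClusterPt.mono h1 (h i)
  exact eq_of_nhds_neBot h2

/-- A discrete mean value inequality. With `Q = 0` it yields Lipschitz bounds in time; with `Q` the
limit slope it yields differentiability. -/
theorem abs_sub_sub_mul_le_of_step {P q : ℕ → ℝ} {h Q ε : ℝ} (hh : 0 ≤ h)
    (hstep : ∀ k, P (k + 1) - P k = h * q k) {j k : ℕ} (hjk : j ≤ k)
    (hq : ∀ m, j ≤ m → m < k → |q m - Q| ≤ ε) :
    |P k - P j - (k * h - j * h) * Q| ≤ (k * h - j * h) * ε := by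
  induction k, hjk using Nat.le_induction with
  | base => simp
  | succ k hjk ih =>
    have h1 := ih fun m hm hmk => hq m hm (by omega)
    have h2 := mul_le_mul_of_nonneg_left (hq k hjk (by omega)) hh
    have h3 : P (k + 1) - P j - ((k + 1 : ℕ) * h - j * h) * Q =
        (P k - P j - (k * h - j * h) * Q) + h * (q k - Q) := by
      push_cast
      linear_combination hstep k
    rw [h3]
    refine (abs_add_le _ _).trans ?_
    rw [abs_mul, abs_of_nonneg hh]
    push_cast
    linarith

theorem abs_floor_mul_sub_le {t h : ℝ} (ht : 0 ≤ t) (hh : 0 < h) :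
    (⌊t / h⌋₊ : ℝ) * h ≤ t ∧ t < ⌊t / h⌋₊ * h + h := by
  have h1 := Nat.floor_le (div_nonneg ht hh.le)
  have h2 := Nat.lt_floor_add_one (t / h)
  rw [le_div_iff₀ hh] at h1
  rw [div_lt_iff₀ hh] at h2
  constructor <;> linarith

/-- Explicit Euler schemes with values in a compact set, tested against a separating family of
continuous functions, have a limit curve, which solves the limit equation. -/
theorem exists_limit_curve {X ι : Type*} [TopologicalSpace X] {K : Set X}
    (hK : IsCompact K) {p : ι → X → ℝ} (hp : ∀ i, Continuous (p i))
    (hsep : ∀ x ∈ K, ∀ y ∈ K, (∀ i, p i x = p i y) → x = y)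
    {v : ℕ → ℕ → X} (hv : ∀ n k, v n k ∈ K) {x₀ : X} (hx₀ : ∀ n, v n 0 = x₀)
    {h : ℕ → ℝ} (hpos : ∀ n, 0 < h n) (hlim : Tendsto h atTop (𝓝 0))
    {q : ι → ℕ → X → ℝ} {Q : ι → X → ℝ}
    (hstep : ∀ i n k, p i (v n (k + 1)) - p i (v n k) = h n * q i n (v n k))
    (hbound : ∀ i, ∃ L, ∀ n, ∀ x ∈ K, |q i n x| ≤ L)
    (hconv : ∀ i, ∀ x ∈ K,
      Tendsto (fun z : ℕ × X => q i z.1 z.2) (atTop ×ˢ 𝓝[K] x) (𝓝 (Q i x))) :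
    ∃ u : ℝ≥0 → X, Continuous u ∧ u 0 = x₀ ∧ (∀ t, u t ∈ K) ∧
      ∀ i, ∀ t : ℝ, 0 < t →
        HasDerivAt (fun s : ℝ => p i (u s.toNNReal)) (Q i (u t.toNNReal)) t := by
  classical
  -- By compactness an ultrafilter provides limits at all times at once, with no diagonal extraction
  -- of subsequences.
  let U : Ultrafilter ℕ := hyperfilter ℕ
  have hU : (U : Filter ℕ) ≤ atTop := Nat.hyperfilter_le_atTop
  have hlimU : Tendsto h U (𝓝 0) := hlim.mono_left hU
  let w : ℝ≥0 → ℕ → X := fun t n => v n ⌊(t : ℝ) / h n⌋₊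
  have hex : ∀ t : ℝ≥0, ∃ x ∈ K, Tendsto (w t) U (𝓝 x) := fun t => by
    have := hK.ultrafilter_le_nhds' (U.map (w t))
      (Filter.mem_map.2 (Filter.Eventually.of_forall fun n => hv n ⌊(t : ℝ) / h n⌋₊))
    simpa [Tendsto] using this
  choose u huK hu using hex
  choose L hL using hbound
  have hL0 : ∀ i, 0 ≤ L i := fun i => (abs_nonneg _).trans (hL i 0 _ (hv 0 0))
  have hfl : ∀ (t : ℝ≥0) n, (⌊(t : ℝ) / h n⌋₊ : ℝ) * h n ≤ t ∧
      t < ⌊(t : ℝ) / h n⌋₊ * h n + h n := fun t n => abs_floor_mul_sub_le t.2 (hpos n)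
  have hflt : ∀ t : ℝ≥0, Tendsto (fun n => (⌊(t : ℝ) / h n⌋₊ : ℝ) * h n) U (𝓝 t) := fun t => by
    refine tendsto_of_tendsto_of_tendsto_of_le_of_le (g := fun n => (t : ℝ) - h n)
      (h := fun _ => (t : ℝ)) ?_ tendsto_const_nhds (fun n => ?_) (fun n => (hfl t n).1)
    · simpa using tendsto_const_nhds.sub hlimU
    · have := (hfl t n).2
      simp only
      linarith
  have hpu : ∀ i t, Tendsto (fun n => p i (w t n)) U (𝓝 (p i (u t))) := fun i t =>
    ((hp i).tendsto _).comp (hu t)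
  have hdisc : ∀ i n j k, |p i (v n k) - p i (v n j)| ≤ |(k : ℝ) * h n - j * h n| * L i := by
    intro i n
    have key : ∀ j k : ℕ, j ≤ k →
        |p i (v n k) - p i (v n j)| ≤ |(k : ℝ) * h n - j * h n| * L i := by
      intro j k hjk
      have h1 := abs_sub_sub_mul_le_of_step (P := fun k => p i (v n k))
        (q := fun k => q i n (v n k)) (Q := 0) (ε := L i) (hpos n).le (hstep i n) hjk
        (fun m _ _ => by simpa using hL i n _ (hv n m))
      have h2 : (j : ℝ) * h n ≤ k * h n :=
        mul_le_mul_of_nonneg_right (by exact_mod_cast hjk) (hpos n).le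
      rw [abs_of_nonneg (sub_nonneg.2 h2)]
      simpa using h1
    intro j k
    rcases le_total j k with hjk | hjk
    · exact key j k hjk
    · rw [abs_sub_comm, abs_sub_comm ((k : ℝ) * h n)]
      exact key k j hjk
  have hlip : ∀ i s t, |p i (u s) - p i (u t)| ≤ |(s : ℝ) - t| * L i := fun i s t =>
    le_of_tendsto_of_tendsto' ((hpu i s).sub (hpu i t)).abs
      (((hflt s).sub (hflt t)).abs.mul_const _) fun n => hdisc i n _ _
  refine ⟨u, ?_, ?_, huK, ?_⟩
  · refine continuous_iff_continuousAt.2 fun t => ?_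
    refine tendsto_of_separating hK hp hsep (Eventually.of_forall huK) (huK t) fun i => ?_
    rw [tendsto_iff_dist_tendsto_zero]
    have h1 : Tendsto (fun s : ℝ≥0 => |(s : ℝ) - t| * L i) (𝓝 t) (𝓝 0) := by
      have : Continuous fun s : ℝ≥0 => |(s : ℝ) - t| * L i := by fun_prop
      simpa using this.tendsto t
    exact squeeze_zero (fun _ => dist_nonneg) (fun s => hlip i s t) h1
  · refine hsep _ (huK 0) _ (hx₀ 0 ▸ hv 0 0) fun i => ?_
    refine tendsto_nhds_unique (hpu i 0) ?_
    simp [w, hx₀]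
  · intro i t ht
    -- `G` describes all grid nodes `(n, k)` with `n` along `U` and time `k h_n` tending to `t`.
    -- Convergence along `G` is uniform over the nodes near `t`, which differentiability requires.
    let G : Filter (ℕ × ℕ) := ((U : Filter ℕ) ×ˢ ⊤) ⊓
      comap (fun z : ℕ × ℕ => (z.2 : ℝ) * h z.1) (𝓝 t)
    have hG1 : Tendsto (fun z : ℕ × ℕ => z.1) G U := tendsto_fst.mono_left inf_le_left
    have hG2 : Tendsto (fun z : ℕ × ℕ => (z.2 : ℝ) * h z.1) G (𝓝 t) :=
      tendsto_comap.mono_left inf_le_right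
    have htt : ((t.toNNReal : ℝ≥0) : ℝ) = t := Real.coe_toNNReal t ht.le
    -- The Lipschitz bound in time compares an arbitrary node near `t` with the floor node defining
    -- `u t`; separation then upgrades convergence of the tests to convergence in `X`.
    have hGv : Tendsto (fun z : ℕ × ℕ => v z.1 z.2) G (𝓝 (u t.toNNReal)) := by
      refine tendsto_of_separating hK hp hsep (Eventually.of_forall fun z => hv _ _) (huK _)
        fun i => ?_
      have h1 := (hpu i t.toNNReal).comp hG1
      have h2 : Tendsto (fun z : ℕ × ℕ =>
          |(z.2 : ℝ) * h z.1 - ⌊(t.toNNReal : ℝ) / h z.1⌋₊ * h z.1| * L i) G (𝓝 0) := by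
        have := ((hG2.sub ((hflt t.toNNReal).comp hG1)).abs).mul_const (L i)
        simpa [htt] using this
      have h3 : Tendsto (fun z : ℕ × ℕ => p i (v z.1 z.2) - p i (w t.toNNReal z.1)) G (𝓝 0) :=
        squeeze_zero_norm (fun z => hdisc i z.1 _ _) h2
      simpa using h3.add h1
    have hGq : Tendsto (fun z : ℕ × ℕ => q i z.1 (v z.1 z.2)) G (𝓝 (Q i (u t.toNNReal))) :=
      (hconv i _ (huK _)).comp ((hG1.mono_right hU).prodMk
        (tendsto_nhdsWithin_iff.2 ⟨hGv, Eventually.of_forall fun z => hv _ _⟩))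
    rw [hasDerivAt_iff_isLittleO, Asymptotics.isLittleO_iff]
    intro ε hε
    have hev := hGq.eventually (Metric.closedBall_mem_nhds _ hε)
    rw [Filter.Eventually, mem_inf_iff] at hev
    obtain ⟨A, hA, D, hD, hAD⟩ := hev
    obtain ⟨E, hE, hDE⟩ := mem_comap.1 hD
    obtain ⟨δ, hδ, hball⟩ := Metric.mem_nhds_iff.1 hE
    rw [mem_prod_top] at hA
    have key : ∀ s s' : ℝ≥0, s ≤ s' → |(s : ℝ) - t| < δ / 2 → |(s' : ℝ) - t| < δ / 2 →
        |p i (u s') - p i (u s) - ((s' : ℝ) - s) * Q i (u t.toNNReal)| ≤ ((s' : ℝ) - s) * ε := by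
      intro s s' hss hs hs'
      refine le_of_tendsto_of_tendsto
        (((hpu i s').sub (hpu i s)).sub (((hflt s').sub (hflt s)).mul_const _)).abs
        (((hflt s').sub (hflt s)).mul_const _) ?_
      -- A floor node can precede its time by up to `h n`; taking `h n < δ / 2` keeps all nodes
      -- between `s` and `s'` within `δ` of `t`.
      filter_upwards [hA, hlimU.eventually (gt_mem_nhds (half_pos hδ))] with n hn hnδ
      refine abs_sub_sub_mul_le_of_step (P := fun k => p i (v n k))
        (q := fun k => q i n (v n k)) (hpos n).le (hstep i n)
        (Nat.floor_le_floor (div_le_div_of_nonneg_right (by exact_mod_cast hss) (hpos n).le))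
        fun m hm hm' => ?_
      have h1 : (⌊(s : ℝ) / h n⌋₊ : ℝ) * h n ≤ m * h n :=
        mul_le_mul_of_nonneg_right (by exact_mod_cast hm) (hpos n).le
      have h2 : (m : ℝ) * h n ≤ (⌊(s' : ℝ) / h n⌋₊ : ℝ) * h n :=
        mul_le_mul_of_nonneg_right (by exact_mod_cast hm'.le) (hpos n).le
      have h3 := hfl s n
      have h4 := hfl s' n
      have h5 : (n, m) ∈ A ∩ D := by
        refine ⟨hn m, hDE (hball ?_)⟩
        rw [Metric.mem_ball, Real.dist_eq, abs_lt]
        rw [abs_lt] at hs hs'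
        constructor <;> simp only <;> linarith
      rw [← hAD] at h5
      simpa [Real.dist_eq] using h5
    have hnear : ∀ᶠ s in 𝓝 t, 0 ≤ s ∧ |s - t| < δ / 2 :=
      (lt_mem_nhds ht).mono (fun _ h => h.le) |>.and
        (Metric.ball_mem_nhds t (half_pos hδ))
    filter_upwards [hnear] with s ⟨hs0, hs⟩
    have hss : ((s.toNNReal : ℝ≥0) : ℝ) = s := Real.coe_toNNReal s hs0
    have ht' : |((t.toNNReal : ℝ≥0) : ℝ) - t| < δ / 2 := by simp [htt, hδ]
    have hs' : |((s.toNNReal : ℝ≥0) : ℝ) - t| < δ / 2 := by rwa [hss]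
    simp only [smul_eq_mul, Real.norm_eq_abs]
    rcases le_total s t with hst | hst
    · have := key _ _ (Real.toNNReal_le_toNNReal hst) hs' ht'
      rw [hss, htt] at this
      rw [abs_of_nonpos (sub_nonpos.2 hst), ← abs_neg]
      convert this using 1
      · congr 1; ring
      · ring
    · have := key _ _ (Real.toNNReal_le_toNNReal hst) ht' hs'
      rw [hss, htt] at this
      rw [abs_of_nonneg (sub_nonneg.2 hst), mul_comm ε]
      exact this

/-! ### Finite measures -/

/-- If both factors are nonzero, normalisation reduces the claim to probability measures and to
continuity of the masses. If one is zero, the mass of the product tends to zero. -/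
theorem continuous_finiteMeasure_prod {α β : Type*} [MeasurableSpace α] [MeasurableSpace β]
    [TopologicalSpace α] [TopologicalSpace β] [Nonempty α] [Nonempty β]
    [SecondCountableTopology α] [SecondCountableTopology β] [TopologicalSpace.PseudoMetrizableSpace α]
    [TopologicalSpace.PseudoMetrizableSpace β] [OpensMeasurableSpace α]
    [OpensMeasurableSpace β] :
    Continuous fun μ : FiniteMeasure α × FiniteMeasure β => μ.1.prod μ.2 := by
  refine continuous_iff_continuousAt.2 fun μ => ?_
  have hm : Continuous fun μ : FiniteMeasure α × FiniteMeasure β => μ.1.mass * μ.2.mass := by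
    fun_prop
  by_cases h : μ.1 = 0 ∨ μ.2 = 0
  · have h1 : μ.1.prod μ.2 = 0 := by rcases h with h | h <;> simp [h]
    rw [ContinuousAt, h1]
    refine FiniteMeasure.tendsto_zero_of_tendsto_zero_mass ?_
    have h2 := hm.tendsto μ
    have h3 : μ.1.mass * μ.2.mass = 0 := by rcases h with h | h <;> simp [h]
    simpa [h3] using h2
  · rw [not_or] at h
    have key : ∀ ν : FiniteMeasure α × FiniteMeasure β, ν.1.prod ν.2 =
        (ν.1.mass * ν.2.mass) • (ν.1.normalize.prod ν.2.normalize).toFiniteMeasure := by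
      intro ν
      apply Subtype.ext
      have e1 := congrArg FiniteMeasure.toMeasure ν.1.self_eq_mass_smul_normalize
      have e2 := congrArg FiniteMeasure.toMeasure ν.2.self_eq_mass_smul_normalize
      change (ν.1 : Measure α).prod (ν.2 : Measure β) = _
      rw [e1, e2]
      simp [FiniteMeasure.toMeasure_smul, Measure.prod_smul_left, Measure.prod_smul_right,
        smul_smul, mul_comm]
    have hn : Tendsto (fun ν : FiniteMeasure α × FiniteMeasure β =>
        (ν.1.normalize.prod ν.2.normalize)) (𝓝 μ) (𝓝 (μ.1.normalize.prod μ.2.normalize)) :=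
      (ProbabilityMeasure.continuous_prod.tendsto (μ.1.normalize, μ.2.normalize)).comp
        ((FiniteMeasure.tendsto_normalize_of_tendsto continuous_fst.continuousAt h.1).prodMk_nhds
        (FiniteMeasure.tendsto_normalize_of_tendsto continuous_snd.continuousAt h.2))
    have := (hm.tendsto μ).smul
      ((ProbabilityMeasure.toFiniteMeasure_continuous.tendsto _).comp hn)
    rw [ContinuousAt, key μ]
    exact this.congr fun ν => (key ν).symm

/-- The bounded continuous truncation of the exponential at height `N`. -/
def truncExp (η : ℝ) (N : ℕ) (x : ℝ≥0) : ℝ≥0 :=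
  min (Real.exp (η * x)).toNNReal N

theorem continuous_truncExp (η : ℝ) (N : ℕ) : Continuous (truncExp η N) := by
  unfold truncExp
  fun_prop

theorem truncExp_le (η : ℝ) (N : ℕ) (x : ℝ≥0) : truncExp η N x ≤ N := min_le_right _ _

theorem iSup_truncExp (η : ℝ) (x : ℝ≥0) :
    ⨆ N, (truncExp η N x : ℝ≥0∞) = ENNReal.ofReal (Real.exp (η * x)) := by
  refine le_antisymm (iSup_le fun N => ?_) ?_
  · exact ENNReal.coe_le_coe.2 (min_le_left _ _)
  · obtain ⟨N, hN⟩ := exists_nat_ge (Real.exp (η * x)).toNNReal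
    refine le_iSup_of_le N ?_
    rw [truncExp, min_eq_left hN]
    rfl

/-- Monotone convergence. As a supremum of continuous functionals, the moment is lower
semicontinuous; its estimates also reduce to bounded functions. -/
theorem expMoment_eq_iSup (η : ℝ) (μ : FiniteMeasure ℝ≥0) :
    expMoment η μ = ⨆ N, ∫⁻ x, truncExp η N x ∂(μ : Measure ℝ≥0) := by
  rw [expMoment, ← lintegral_iSup]
  · simp_rw [iSup_truncExp]
  · exact fun N => (continuous_truncExp η N).measurable.coe_nnreal_ennreal
  · intro N N' h x
    exact ENNReal.coe_le_coe.2 (min_le_min_left _ (by exact_mod_cast h))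

theorem continuous_lintegral_truncExp (η : ℝ) (N : ℕ) :
    Continuous fun μ : FiniteMeasure ℝ≥0 => ∫⁻ x, truncExp η N x ∂(μ : Measure ℝ≥0) := by
  let f : ℝ≥0 →ᵇ ℝ≥0 := BoundedContinuousFunction.mkOfBound ⟨_, continuous_truncExp η N⟩ N
    fun x y => by
      have h1 : (truncExp η N x : ℝ) ≤ N := by exact_mod_cast truncExp_le η N x
      have h2 : (truncExp η N y : ℝ) ≤ N := by exact_mod_cast truncExp_le η N y
      have h3 := (truncExp η N x).2
      have h4 := (truncExp η N y).2
      simp only [ContinuousMap.coe_mk, NNReal.dist_eq]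
      rw [abs_le]
      constructor <;> linarith
  have h1 : Continuous fun μ : FiniteMeasure ℝ≥0 => μ.testAgainstNN f :=
    FiniteMeasure.continuous_testAgainstNN_eval f
  have h2 := ENNReal.continuous_coe.comp h1
  refine h2.congr fun μ => ?_
  exact FiniteMeasure.testAgainstNN_coe_eq

theorem isClosed_expMoment_le (η : ℝ) (c : ℝ≥0∞) :
    IsClosed {μ : FiniteMeasure ℝ≥0 | expMoment η μ ≤ c} := by
  simp_rw [expMoment_eq_iSup, iSup_le_iff, ofPred_forall]
  exact isClosed_iInter fun N => isClosed_le (continuous_lintegral_truncExp η N) continuous_const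

/-- The finite measures of mass `M` with exponential moment at most `c`. -/
def momentSet (η : ℝ) (M : ℝ≥0) (c : ℝ≥0∞) : Set (FiniteMeasure ℝ≥0) :=
  {μ | μ.mass = M ∧ expMoment η μ ≤ c}

/-- Markov's inequality bounds the mass outside `[0, n]` by `c e^{-ηn}`, so Prokhorov's criterion
applies; closedness follows from lower semicontinuity of the moment. -/
theorem isCompact_momentSet {η : ℝ} (hη : 0 < η) (M : ℝ≥0) {c : ℝ≥0∞} (hc : c < ⊤) :
    IsCompact (momentSet η M c) := by
  have hlim : Tendsto (fun n : ℕ => c.toNNReal * (Real.exp (-(η * n))).toNNReal) atTop (𝓝 0) := by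
    have h1 : Tendsto (fun n : ℕ => Real.exp (-(η * n))) atTop (𝓝 0) :=
      Real.tendsto_exp_neg_atTop_nhds_zero.comp
        (tendsto_natCast_atTop_atTop.const_mul_atTop hη)
    have h2 := ((continuous_real_toNNReal.tendsto 0).comp h1).const_mul c.toNNReal
    simpa using h2
  have hK := isCompact_setOfPred_finiteMeasure_mass_eq_compl_isCompact_le (E := ℝ≥0) M hlim
    (K := fun n => Icc 0 (n : ℝ≥0)) (fun n => isCompact_Icc) (Or.inl inferInstance)
  refine hK.of_isClosed_subset ?_ ?_
  · refine IsClosed.inter (isClosed_eq (by fun_prop) continuous_const)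
      (isClosed_expMoment_le η c)
  · rintro μ ⟨hμ, hμc⟩
    refine ⟨hμ, fun n => ?_⟩
    rw [← ENNReal.coe_le_coe, FiniteMeasure.ennreal_coeFn_eq_coeFn_toMeasure, ENNReal.coe_mul,
      ENNReal.coe_toNNReal hc.ne]
    have h1 : ENNReal.ofReal (Real.exp (η * n)) * (μ : Measure ℝ≥0) (Icc 0 (n : ℝ≥0))ᶜ ≤ c := by
      refine le_trans ?_ hμc
      refine le_trans ?_ (mul_meas_ge_le_lintegral₀ (by fun_prop)
        (ENNReal.ofReal (Real.exp (η * n))))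
      gcongr
      intro x hx
      have hx' : (n : ℝ≥0) < x := by
        by_contra! h
        exact hx ⟨zero_le, h⟩
      refine ENNReal.ofReal_le_ofReal (Real.exp_le_exp.2 ?_)
      have : (n : ℝ) ≤ x := by exact_mod_cast hx'.le
      gcongr
    calc (μ : Measure ℝ≥0) (Icc 0 (n : ℝ≥0))ᶜ
        = ENNReal.ofReal (Real.exp (-(η * n))) * (ENNReal.ofReal (Real.exp (η * n)) *
          (μ : Measure ℝ≥0) (Icc 0 (n : ℝ≥0))ᶜ) := by
          rw [← mul_assoc, ← ENNReal.ofReal_mul (Real.exp_pos _).le, ← Real.exp_add]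
          simp
      _ ≤ ENNReal.ofReal (Real.exp (-(η * n))) * c := by gcongr
      _ = _ := by rw [mul_comm]; rfl

/-! ### Separation of finite measures by smooth functions -/

/-- A smooth approximation, from above, of the indicator function of `[0, a]`. -/
def smoothCutoff (a : ℝ) (m : ℕ) (x : ℝ) : ℝ :=
  Real.smoothTransition (1 - m * (x ^ 2 - a ^ 2))

theorem contDiff_smoothCutoff (a : ℝ) (m : ℕ) : ContDiff ℝ ∞ (smoothCutoff a m) :=
  Real.smoothTransition.contDiff.comp (by fun_prop)

theorem abs_smoothCutoff_le (a : ℝ) (m : ℕ) (x : ℝ) : |smoothCutoff a m x| ≤ 1 := by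
  rw [smoothCutoff, abs_of_nonneg (Real.smoothTransition.nonneg _)]
  exact Real.smoothTransition.le_one _

theorem tendsto_smoothCutoff {a x : ℝ} (ha : 0 ≤ a) (hx : 0 ≤ x) :
    Tendsto (fun m => smoothCutoff a m x) atTop (𝓝 ((Iic a).indicator 1 x)) := by
  by_cases h : x ≤ a
  · rw [indicator_of_mem (mem_Iic.2 h)]
    refine tendsto_const_nhds.congr fun m => ?_
    rw [smoothCutoff, Real.smoothTransition.one_of_one_le]
    · rfl
    · have : x ^ 2 ≤ a ^ 2 := by gcongr
      have := mul_nonneg (m.cast_nonneg (α := ℝ)) (sub_nonneg.2 this)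
      linarith
  · rw [indicator_of_notMem (by simpa using h)]
    rw [not_le] at h
    have h1 : 0 < x ^ 2 - a ^ 2 := by nlinarith
    refine tendsto_const_nhds.congr' ?_
    filter_upwards [(tendsto_natCast_atTop_atTop.atTop_mul_const h1).eventually_ge_atTop
      (1 : ℝ)] with m hm
    rw [smoothCutoff, Real.smoothTransition.zero_of_nonpos]
    linarith

theorem hasCompactSupport_smoothCutoff (a : ℝ) {m : ℕ} (hm : m ≠ 0) :
    HasCompactSupport (smoothCutoff a m) := by
  refine HasCompactSupport.intro (isCompact_Icc (a := -(|a| + 1)) (b := |a| + 1)) fun x hx => ?_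
  rw [smoothCutoff, Real.smoothTransition.zero_of_nonpos]
  have h1 : |a| + 1 < |x| := by
    by_contra! h
    exact hx (abs_le.1 h)
  have h2 : a ^ 2 + 1 ≤ x ^ 2 := by
    rw [← sq_abs a, ← sq_abs x]
    nlinarith [abs_nonneg a]
  have h3 : (1 : ℝ) ≤ m := by exact_mod_cast Nat.one_le_iff_ne_zero.2 hm
  nlinarith

theorem derivWithin_smoothCutoff (a : ℝ) (m : ℕ) {x : ℝ} (hx : 0 ≤ x) :
    derivWithin (smoothCutoff a m) (Ici 0) x = deriv (smoothCutoff a m) x :=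
  ((contDiff_smoothCutoff a m).differentiable (by simp) x).derivWithin
    (uniqueDiffOn_Ici 0 x hx)

theorem isC1b_smoothCutoff (a : ℝ) {m : ℕ} (hm : m ≠ 0) : IsC1b (smoothCutoff a m) where
  contDiffOn := ((contDiff_smoothCutoff a m).of_le (by simp)).contDiffOn
  bounded := ⟨1, fun x _ => abs_smoothCutoff_le a m x⟩
  deriv_bounded := by
    obtain ⟨M, hM⟩ := ((contDiff_smoothCutoff a m).continuous_deriv
      (by simp)).bounded_above_of_compact_support (hasCompactSupport_smoothCutoff a hm).deriv
    exact ⟨M, fun x hx => by rw [derivWithin_smoothCutoff a m hx]; exact hM x⟩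

/-- The cutoff depends on `x` only through `x ^ 2`, which is what makes it an admissible test
function. -/
theorem derivWithin_smoothCutoff_zero (a : ℝ) (m : ℕ) :
    derivWithin (smoothCutoff a m) (Ici 0) 0 = 0 := by
  rw [derivWithin_smoothCutoff a m le_rfl]
  have h1 : HasDerivAt (fun x : ℝ => 1 - m * (x ^ 2 - a ^ 2)) 0 0 := by
    have := (((hasDerivAt_pow 2 (0 : ℝ)).sub_const (a ^ 2)).const_mul (m : ℝ)).const_sub 1
    simpa using this
  have h2 := (Real.smoothTransition.contDiff (n := 1)).differentiable (by simp)
    (1 - m * ((0 : ℝ) ^ 2 - a ^ 2))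
  have h3 := h2.hasDerivAt.comp (0 : ℝ) h1
  rw [mul_zero] at h3
  exact h3.deriv

/-- Dominated convergence along the cutoffs recovers the values on all `[0, a]`, and these determine
a finite measure. The index is shifted to `m + 1` because the cutoff with `m = 0` is constant and
not compactly supported. -/
theorem finiteMeasure_ext_of_isC1b {μ ν : FiniteMeasure ℝ≥0}
    (h : ∀ φ : ℝ → ℝ, IsC1b φ → derivWithin φ (Ici 0) 0 = 0 →
      ∫ x, φ (x : ℝ≥0) ∂(μ : Measure ℝ≥0) = ∫ x, φ (x : ℝ≥0) ∂(ν : Measure ℝ≥0)) : μ = ν := by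
  apply Subtype.ext
  refine Measure.ext_of_Iic (μ : Measure ℝ≥0) (ν : Measure ℝ≥0) fun a => ?_
  have key : ∀ μ : FiniteMeasure ℝ≥0, Tendsto
      (fun m => ∫ x, smoothCutoff a (m + 1) (x : ℝ≥0) ∂(μ : Measure ℝ≥0)) atTop
      (𝓝 ((μ : Measure ℝ≥0).real (Iic a))) := by
    intro μ
    rw [← integral_indicator_one measurableSet_Iic]
    refine tendsto_integral_of_dominated_convergence (fun _ => 1)
      (fun m => ((contDiff_smoothCutoff a (m + 1)).continuous.comp
        NNReal.continuous_coe).aestronglyMeasurable)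
      (integrable_const _) (fun m => ae_of_all _ fun x => abs_smoothCutoff_le a (m + 1) x)
      (ae_of_all _ fun x => ?_)
    have := (tendsto_smoothCutoff a.2 x.2).comp (tendsto_add_atTop_nat 1)
    have hind : (Iic a).indicator (1 : ℝ≥0 → ℝ) x = (Iic (a : ℝ)).indicator 1 (x : ℝ) := by
      by_cases hxa : x ≤ a <;> simp [indicator, hxa]
    rw [hind]
    exact this
  have h1 := tendsto_nhds_unique ((key ν).congr fun m => (h _
    (isC1b_smoothCutoff a m.succ_ne_zero) (derivWithin_smoothCutoff_zero a _)).symm) (key μ)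
  exact ((measureReal_eq_measureReal_iff).1 h1).symm

section

/-! ### The explicit Euler step -/

/-- The density of one explicit Euler step of length `h` for `∂ₜμ = μ ∫ r(·, y) dμ(y)`, with respect
to `μ`. -/
def eulerDensity (r : ℝ≥0 → ℝ≥0 → ℝ) (h : ℝ) (μ : Measure ℝ≥0) (x : ℝ≥0) : ℝ :=
  1 + h * ∫ y, r x y ∂μ

/-- A bounded measurable antisymmetric kernel. -/
structure IsBoundedAntisymm (r : ℝ≥0 → ℝ≥0 → ℝ) (A : ℝ) : Prop where
  measurable : Measurable fun p : ℝ≥0 × ℝ≥0 => r p.1 p.2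
  antisymm : ∀ x y, r y x = -r x y
  bound : ∀ x y, |r x y| ≤ A

variable {r : ℝ≥0 → ℝ≥0 → ℝ} {A h : ℝ}

theorem IsBoundedAntisymm.measurable_eulerDensity (hr : IsBoundedAntisymm r A)
    (h : ℝ) (μ : FiniteMeasure ℝ≥0) : Measurable (eulerDensity r h μ) :=
  (hr.measurable.stronglyMeasurable.integral_prod_right'.measurable.const_mul h).const_add 1

theorem IsBoundedAntisymm.abs_integral_le (hr : IsBoundedAntisymm r A) (μ : FiniteMeasure ℝ≥0)
    (x : ℝ≥0) : |∫ y, r x y ∂(μ : Measure ℝ≥0)| ≤ A * μ.mass := by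
  have := norm_integral_le_of_norm_le_const (μ := (μ : Measure ℝ≥0))
    (f := fun y => r x y) (ae_of_all _ fun y => hr.bound x y)
  simpa using this

theorem IsBoundedAntisymm.eulerDensity_nonneg (hr : IsBoundedAntisymm r A) (hh : 0 ≤ h)
    {μ : FiniteMeasure ℝ≥0} (hA : h * (A * μ.mass) ≤ 1) (x : ℝ≥0) :
    0 ≤ eulerDensity r h μ x := by
  have h1 := mul_le_mul_of_nonneg_left (neg_le_of_abs_le (hr.abs_integral_le μ x)) hh
  unfold eulerDensity
  linarith

theorem IsBoundedAntisymm.eulerDensity_le (hr : IsBoundedAntisymm r A) (hh : 0 ≤ h)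
    (μ : FiniteMeasure ℝ≥0) (x : ℝ≥0) : eulerDensity r h μ x ≤ 1 + h * (A * μ.mass) := by
  have h1 := mul_le_mul_of_nonneg_left (le_of_abs_le (hr.abs_integral_le μ x)) hh
  unfold eulerDensity
  linarith

theorem IsBoundedAntisymm.isFiniteMeasure_withDensity (hr : IsBoundedAntisymm r A) (hh : 0 ≤ h)
    (μ : FiniteMeasure ℝ≥0) : IsFiniteMeasure
      ((μ : Measure ℝ≥0).withDensity fun x => ENNReal.ofReal (eulerDensity r h μ x)) := by
  refine MeasureTheory.isFiniteMeasure_withDensity (ne_of_lt ?_)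
  calc ∫⁻ x, ENNReal.ofReal (eulerDensity r h μ x) ∂(μ : Measure ℝ≥0)
      ≤ ∫⁻ _, ENNReal.ofReal (1 + h * (A * μ.mass)) ∂(μ : Measure ℝ≥0) :=
        lintegral_mono fun x => ENNReal.ofReal_le_ofReal (hr.eulerDensity_le hh μ x)
    _ < ⊤ := by
      rw [lintegral_const]
      exact ENNReal.mul_lt_top ENNReal.ofReal_lt_top (measure_lt_top _ _)

/-- The Euler step as a finite measure. -/
def eulerStep (hr : IsBoundedAntisymm r A) (hh : 0 ≤ h) (μ : FiniteMeasure ℝ≥0) :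
    FiniteMeasure ℝ≥0 :=
  ⟨(μ : Measure ℝ≥0).withDensity fun x => ENNReal.ofReal (eulerDensity r h μ x),
    hr.isFiniteMeasure_withDensity hh μ⟩

theorem integrable_of_bounded_measurable {α : Type*} [MeasurableSpace α] {μ : Measure α}
    [IsFiniteMeasure μ] {f : α → ℝ} (hf : Measurable f) {c : ℝ} (hc : ∀ x, |f x| ≤ c) :
    Integrable f μ :=
  Integrable.of_bound hf.aestronglyMeasurable c (ae_of_all _ hc)

/-- Exchanging the variables and using antisymmetry symmetrises `∬ r(x, y) f(x)`, so one step
reproduces the weak form exactly. The restriction on `h` keeps the density nonnegative, so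
`ENNReal.ofReal` loses nothing. -/
theorem IsBoundedAntisymm.integral_eulerStep (hr : IsBoundedAntisymm r A) (hh : 0 ≤ h)
    {μ : FiniteMeasure ℝ≥0} (hA : h * (A * μ.mass) ≤ 1) {f : ℝ≥0 → ℝ} (hf : Measurable f)
    {c : ℝ} (hc : ∀ x, |f x| ≤ c) :
    ∫ x, f x ∂(eulerStep hr hh μ : Measure ℝ≥0) = ∫ x, f x ∂(μ : Measure ℝ≥0) +
      h * ((1 / 2) * ∫ p : ℝ≥0 × ℝ≥0, r p.1 p.2 * (f p.1 - f p.2)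
        ∂((μ : Measure ℝ≥0).prod (μ : Measure ℝ≥0))) := by
  have hA0 : 0 ≤ A := (abs_nonneg _).trans (hr.bound 0 0)
  have hc0 : 0 ≤ c := (abs_nonneg _).trans (hc 0)
  have h1 : ∫ x, f x ∂(eulerStep hr hh μ : Measure ℝ≥0) =
      ∫ x, eulerDensity r h μ x * f x ∂(μ : Measure ℝ≥0) := by
    change ∫ x, f x ∂((μ : Measure ℝ≥0).withDensity _) = _
    rw [integral_withDensity_eq_integral_toReal_smul
      (hr.measurable_eulerDensity h μ).ennreal_ofReal (ae_of_all _ fun _ => ENNReal.ofReal_lt_top)]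
    refine integral_congr_ae (ae_of_all _ fun x => ?_)
    simp only [ENNReal.toReal_ofReal (hr.eulerDensity_nonneg hh hA x), smul_eq_mul]
  have hint1 : Integrable (fun p : ℝ≥0 × ℝ≥0 => r p.1 p.2 * f p.1)
      ((μ : Measure ℝ≥0).prod (μ : Measure ℝ≥0)) := by
    refine integrable_of_bounded_measurable (hr.measurable.mul (hf.comp measurable_fst))
      (c := A * c) fun p => ?_
    rw [abs_mul]
    exact mul_le_mul (hr.bound _ _) (hc _) (abs_nonneg _) hA0
  have hint2 : Integrable (fun p : ℝ≥0 × ℝ≥0 => r p.1 p.2 * f p.2)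
      ((μ : Measure ℝ≥0).prod (μ : Measure ℝ≥0)) := by
    refine integrable_of_bounded_measurable (hr.measurable.mul (hf.comp measurable_snd))
      (c := A * c) fun p => ?_
    rw [abs_mul]
    exact mul_le_mul (hr.bound _ _) (hc _) (abs_nonneg _) hA0
  have hswap : ∫ p : ℝ≥0 × ℝ≥0, r p.1 p.2 * f p.2 ∂((μ : Measure ℝ≥0).prod (μ : Measure ℝ≥0)) =
      -∫ p : ℝ≥0 × ℝ≥0, r p.1 p.2 * f p.1 ∂((μ : Measure ℝ≥0).prod (μ : Measure ℝ≥0)) := by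
    rw [← integral_prod_swap, ← integral_neg]
    refine integral_congr_ae (ae_of_all _ fun p => ?_)
    simp only [Prod.fst_swap, Prod.snd_swap]
    rw [hr.antisymm p.1 p.2]
    ring
  have h2 : ∫ p : ℝ≥0 × ℝ≥0, r p.1 p.2 * (f p.1 - f p.2)
      ∂((μ : Measure ℝ≥0).prod (μ : Measure ℝ≥0)) =
      2 * ∫ p : ℝ≥0 × ℝ≥0, r p.1 p.2 * f p.1 ∂((μ : Measure ℝ≥0).prod (μ : Measure ℝ≥0)) := by
    simp_rw [mul_sub]
    rw [integral_sub hint1 hint2, hswap]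
    ring
  have h3 : ∫ p : ℝ≥0 × ℝ≥0, r p.1 p.2 * f p.1 ∂((μ : Measure ℝ≥0).prod (μ : Measure ℝ≥0)) =
      ∫ x, (∫ y, r x y ∂(μ : Measure ℝ≥0)) * f x ∂(μ : Measure ℝ≥0) := by
    rw [integral_prod _ hint1]
    simp_rw [integral_mul_const]
  have hint3 : Integrable (fun x => (∫ y, r x y ∂(μ : Measure ℝ≥0)) * f x) (μ : Measure ℝ≥0) := by
    refine integrable_of_bounded_measurable
      (hr.measurable.stronglyMeasurable.integral_prod_right'.measurable.mul hf)
      (c := A * μ.mass * c) fun p => ?_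
    rw [abs_mul]
    exact mul_le_mul (hr.abs_integral_le μ p) (hc _) (abs_nonneg _) (by positivity)
  have hint4 : Integrable f (μ : Measure ℝ≥0) := integrable_of_bounded_measurable hf hc
  rw [h1, h2, h3]
  simp_rw [eulerDensity, add_mul, one_mul, mul_assoc]
  rw [integral_add hint4 (hint3.const_mul h), integral_const_mul]
  ring

theorem IsBoundedAntisymm.mass_eulerStep (hr : IsBoundedAntisymm r A) (hh : 0 ≤ h)
    {μ : FiniteMeasure ℝ≥0} (hA : h * (A * μ.mass) ≤ 1) :
    (eulerStep hr hh μ).mass = μ.mass := by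
  have h1 := hr.integral_eulerStep hh hA (f := fun _ => 1) measurable_const (c := 1) (by simp)
  have h2 : ∀ ν : FiniteMeasure ℝ≥0, (ν : Measure ℝ≥0).real univ = ν.mass := fun _ => rfl
  simp only [integral_const, smul_eq_mul, mul_one, sub_self, mul_zero, add_zero, h2] at h1
  exact_mod_cast h1

/-- If the kernel drives mass towards the origin, the Euler step does not increase the exponential
moment. -/
theorem IsBoundedAntisymm.expMoment_eulerStep_le (hr : IsBoundedAntisymm r A) (hh : 0 ≤ h)
    {μ : FiniteMeasure ℝ≥0} (hA : h * (A * μ.mass) ≤ 1)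
    (hneg : ∀ x y, x ≤ y → 0 ≤ r x y) {η : ℝ} (hη : 0 ≤ η) :
    expMoment η (eulerStep hr hh μ) ≤ expMoment η μ := by
  rw [expMoment_eq_iSup, expMoment_eq_iSup]
  refine iSup_mono fun N => ?_
  have hmono : Monotone (truncExp η N) := fun x y hxy =>
    min_le_min_right _ (Real.toNNReal_le_toNNReal (Real.exp_le_exp.2 (by gcongr)))
  have hmeas : Measurable fun x => (truncExp η N x : ℝ) :=
    (continuous_truncExp η N).measurable.coe_nnreal_real
  have hbd : ∀ x, |(truncExp η N x : ℝ)| ≤ N := fun x => by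
    rw [abs_of_nonneg (truncExp η N x).coe_nonneg]
    exact_mod_cast truncExp_le η N x
  have h1 := hr.integral_eulerStep hh hA hmeas hbd
  have h2 : ∫ p : ℝ≥0 × ℝ≥0, r p.1 p.2 * ((truncExp η N p.1 : ℝ) - truncExp η N p.2)
      ∂((μ : Measure ℝ≥0).prod (μ : Measure ℝ≥0)) ≤ 0 := by
    -- For either order of the two points, the kernel and the increment of the increasing function
    -- `truncExp` have opposite signs.
    refine integral_nonpos fun p => ?_
    rcases le_total p.1 p.2 with hp | hp
    · refine mul_nonpos_of_nonneg_of_nonpos (hneg _ _ hp) (sub_nonpos.2 ?_)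
      exact_mod_cast hmono hp
    · refine mul_nonpos_of_nonpos_of_nonneg ?_ (sub_nonneg.2 ?_)
      · have := hneg _ _ hp
        rw [hr.antisymm p.1 p.2] at this
        linarith
      · exact_mod_cast hmono hp
  have h3 : ∀ ν : FiniteMeasure ℝ≥0, ∫⁻ x, truncExp η N x ∂(ν : Measure ℝ≥0) =
      ENNReal.ofReal (∫ x, (truncExp η N x : ℝ) ∂(ν : Measure ℝ≥0)) := fun ν => by
    rw [ofReal_integral_eq_lintegral_ofReal (integrable_of_bounded_measurable hmeas hbd)
      (ae_of_all _ fun x => (truncExp η N x).2)]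
    simp
  rw [h3, h3]
  refine ENNReal.ofReal_le_ofReal ?_
  have h4 := mul_nonneg hh (neg_nonneg.2 h2)
  rw [h1]
  linarith

end

section

/-! ### The collision form -/

variable {B : ℝ≥0 → ℝ≥0 → ℝ} {θ δ ρ C : ℝ}

/-- The quadratic form `½ ∬ F d(μ ⊗ μ)`. -/
def quadForm (F : ℝ≥0 × ℝ≥0 → ℝ) (μ : FiniteMeasure ℝ≥0) : ℝ :=
  (1 / 2 : ℝ) * ∫ p, F p ∂((μ : Measure ℝ≥0).prod (μ : Measure ℝ≥0))

theorem integrable_exp_of_expMoment {η : ℝ} {μ : FiniteMeasure ℝ≥0} (h : expMoment η μ < ⊤) :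
    Integrable (fun x : ℝ≥0 => Real.exp (η * x)) (μ : Measure ℝ≥0) := by
  refine ⟨by fun_prop, ?_⟩
  rw [hasFiniteIntegral_iff_ofReal (ae_of_all _ fun x => (Real.exp_pos _).le)]
  exact h

theorem integrable_weight {η : ℝ} {μ : FiniteMeasure ℝ≥0} (h : expMoment η μ < ⊤) :
    Integrable (weight η) ((μ : Measure ℝ≥0).prod (μ : Measure ℝ≥0)) :=
  ((integrable_exp_of_expMoment h).comp_fst _).add ((integrable_exp_of_expMoment h).comp_snd _)

theorem integral_weight_le {η : ℝ} {M : ℝ≥0} {c : ℝ≥0∞} (hc : c < ⊤) {μ : FiniteMeasure ℝ≥0}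
    (hμ : μ ∈ momentSet η M c) :
    ∫ p, weight η p ∂((μ : Measure ℝ≥0).prod (μ : Measure ℝ≥0)) ≤ 2 * (M * c.toReal) := by
  have hi := integrable_exp_of_expMoment (hμ.2.trans_lt hc)
  have hm : (μ : Measure ℝ≥0).real univ = M := by
    rw [← hμ.1]
    rfl
  have he : ∫ x : ℝ≥0, Real.exp (η * x) ∂(μ : Measure ℝ≥0) ≤ c.toReal := by
    rw [integral_eq_lintegral_of_nonneg_ae (ae_of_all _ fun x => (Real.exp_pos _).le)
      (by fun_prop)]
    exact ENNReal.toReal_mono hc.ne hμ.2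
  unfold weight
  rw [integral_add (hi.comp_fst _) (hi.comp_snd _),
    integral_fun_fst (fun x : ℝ≥0 => Real.exp (η * x)),
    integral_fun_snd (fun x : ℝ≥0 => Real.exp (η * x)), hm, smul_eq_mul]
  have := mul_le_mul_of_nonneg_left he M.coe_nonneg
  linarith

theorem abs_integral_sub_le {α : Type*} [MeasurableSpace α] {μ : Measure α} {f g G : α → ℝ}
    (hf : Integrable f μ) (hg : Integrable g μ) (hG : Integrable G μ) {ε : ℝ}
    (h : ∀ x, |f x - g x| ≤ ε * G x) :
    |∫ x, f x ∂μ - ∫ x, g x ∂μ| ≤ ε * ∫ x, G x ∂μ := by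
  rw [← integral_sub hf hg, ← integral_const_mul]
  exact norm_integral_le_of_norm_le (f := fun x => f x - g x) (hG.const_mul ε) (ae_of_all _ h)

theorem IsKernel.integrable_collisionIntegrand (hB : IsKernel B θ δ ρ C) {φ : ℝ → ℝ}
    (hφ : IsC1b φ) (h0 : derivWithin φ (Ici 0) 0 = 0) {η : ℝ} (hη : (1 - θ) / 2 < η)
    {μ : FiniteMeasure ℝ≥0} (h : expMoment η μ < ⊤) :
    Integrable (collisionIntegrand B φ) ((μ : Measure ℝ≥0).prod (μ : Measure ℝ≥0)) := by
  obtain ⟨K, -, hK⟩ := hB.exists_abs_collisionIntegrand_le hφ hη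
  exact ((integrable_weight h).const_mul K).mono'
    (hB.continuous_collisionIntegrand hφ h0).aestronglyMeasurable (ae_of_all _ hK)

theorem IsKernel.measurable_truncIntegrand (hB : IsKernel B θ δ ρ C) {φ : ℝ → ℝ}
    (hφ : IsC1b φ) (n : ℕ) : Measurable (truncIntegrand B n φ) :=
  (hB.measurable_truncR n).mul ((hφ.continuous_coe.measurable.comp measurable_fst).sub
    (hφ.continuous_coe.measurable.comp measurable_snd))

theorem IsKernel.integrable_truncIntegrand (hB : IsKernel B θ δ ρ C) {φ : ℝ → ℝ}
    (hφ : IsC1b φ) (n : ℕ) {η : ℝ} (hη : (1 - θ) / 2 < η)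
    {μ : FiniteMeasure ℝ≥0} (h : expMoment η μ < ⊤) :
    Integrable (truncIntegrand B n φ) ((μ : Measure ℝ≥0).prod (μ : Measure ℝ≥0)) := by
  obtain ⟨K, -, hK⟩ := hB.exists_abs_collisionIntegrand_le hφ hη
  exact ((integrable_weight h).const_mul K).mono'
    (hB.measurable_truncIntegrand hφ n).aestronglyMeasurable
    (ae_of_all _ fun p => (hB.abs_truncIntegrand_le n φ p).trans (hK p))

theorem abs_quadForm_le {F : ℝ≥0 × ℝ≥0 → ℝ} {η K : ℝ} (hK0 : 0 ≤ K)
    (hK : ∀ p, |F p| ≤ K * weight η p) {M : ℝ≥0} {c : ℝ≥0∞} (hc : c < ⊤)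
    {μ : FiniteMeasure ℝ≥0} (hμ : μ ∈ momentSet η M c) :
    |quadForm F μ| ≤ K * (M * c.toReal) := by
  have h1 := norm_integral_le_of_norm_le (f := F)
    ((integrable_weight (hμ.2.trans_lt hc)).const_mul K) (ae_of_all _ hK)
  rw [integral_const_mul, Real.norm_eq_abs] at h1
  have h2 := mul_le_mul_of_nonneg_left (integral_weight_le hc hμ) hK0
  rw [quadForm, abs_mul, abs_of_nonneg (by norm_num : (0 : ℝ) ≤ 1 / 2)]
  linarith

/-- The convergence is joint in the truncation height and the measure. The bounded function `H`
passes to the limit by narrow continuity of `ν ↦ ν ⊗ ν`; all other errors are bounded by the weight,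
whose integral is uniformly bounded on `momentSet`. -/
theorem IsKernel.tendsto_quadForm (hB : IsKernel B θ δ ρ C) {φ : ℝ → ℝ}
    (hφ : IsC1b φ) (h0 : derivWithin φ (Ici 0) 0 = 0) {η : ℝ} (hη : (1 - θ) / 2 < η)
    {M : ℝ≥0} {c : ℝ≥0∞} (hc : c < ⊤) {μ : FiniteMeasure ℝ≥0} (hμ : μ ∈ momentSet η M c) :
    Tendsto (fun z : ℕ × FiniteMeasure ℝ≥0 => quadForm (truncIntegrand B z.1 φ) z.2)
      (atTop ×ˢ 𝓝[momentSet η M c] μ) (𝓝 (quadForm (collisionIntegrand B φ) μ)) := by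
  refine Tendsto.const_mul _ ?_
  rw [Metric.tendsto_nhds]
  intro ε hε
  set D : ℝ := 2 * (M * c.toReal) with hD
  have hD0 : 0 ≤ D := by positivity
  -- Three errors of size `ε' * D` (truncation at `ν`, replacement by `H` at `ν` and at `μ`) must
  -- total less than `ε / 2`; the `+ 1` covers `D = 0`.
  set ε' := ε / (6 * (D + 1)) with hε'
  have hε'0 : 0 < ε' := by positivity
  have hsmall : 3 * (ε' * D) < ε / 2 := by
    have : ε' * (6 * (D + 1)) = ε := div_mul_cancel₀ _ (by positivity)
    nlinarith
  obtain ⟨n₀, hn₀⟩ := hB.exists_truncIntegrand_approx hφ h0 hη hε'0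
  obtain ⟨H, hH⟩ := hB.exists_bounded_approx hφ h0 hη hε'0
  have hHc : Tendsto (fun ν : FiniteMeasure ℝ≥0 =>
      ∫ p, H p ∂((ν : Measure ℝ≥0).prod (ν : Measure ℝ≥0))) (𝓝[momentSet η M c] μ)
      (𝓝 (∫ p, H p ∂((μ : Measure ℝ≥0).prod (μ : Measure ℝ≥0)))) := by
    have h1 : Tendsto (fun ν : FiniteMeasure ℝ≥0 => ν.prod ν) (𝓝 μ) (𝓝 (μ.prod μ)) :=
      (continuous_finiteMeasure_prod.comp (continuous_id.prodMk continuous_id)).tendsto μ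
    exact (FiniteMeasure.tendsto_iff_forall_integral_tendsto.1 h1 H).mono_left
      nhdsWithin_le_nhds
  have hev : ∀ᶠ ν : FiniteMeasure ℝ≥0 in 𝓝[momentSet η M c] μ,
      dist (∫ p, H p ∂((ν : Measure ℝ≥0).prod (ν : Measure ℝ≥0)))
        (∫ p, H p ∂((μ : Measure ℝ≥0).prod (μ : Measure ℝ≥0))) < ε / 2 ∧
      ν ∈ momentSet η M c :=
    (Metric.tendsto_nhds.1 hHc _ (half_pos hε)).and self_mem_nhdsWithin
  have hclose : ∀ ν ∈ momentSet η M c,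
      |∫ p, collisionIntegrand B φ p ∂((ν : Measure ℝ≥0).prod (ν : Measure ℝ≥0)) -
        ∫ p, H p ∂((ν : Measure ℝ≥0).prod (ν : Measure ℝ≥0))| ≤ ε' * D := fun ν hν => by
    have hν' := hν.2.trans_lt hc
    exact (abs_integral_sub_le (hB.integrable_collisionIntegrand hφ h0 hη hν')
      (H.integrable _) (integrable_weight hν') hH).trans
      (mul_le_mul_of_nonneg_left (integral_weight_le hc hν) hε'0.le)
  filter_upwards [(eventually_ge_atTop n₀).prod_mk hev]
  rintro ⟨n, ν⟩ ⟨hn, hν1, hν2⟩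
  simp only at hn hν1 hν2 ⊢
  have hν' := hν2.2.trans_lt hc
  have e1 : |∫ p, truncIntegrand B n φ p ∂((ν : Measure ℝ≥0).prod (ν : Measure ℝ≥0)) -
      ∫ p, collisionIntegrand B φ p ∂((ν : Measure ℝ≥0).prod (ν : Measure ℝ≥0))| ≤ ε' * D :=
    (abs_integral_sub_le (hB.integrable_truncIntegrand hφ n hη hν')
      (hB.integrable_collisionIntegrand hφ h0 hη hν') (integrable_weight hν') (hn₀ n hn)).trans
      (mul_le_mul_of_nonneg_left (integral_weight_le hc hν2) hε'0.le)
  have e2 := hclose ν hν2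
  have e3 := hclose μ hμ
  rw [Real.dist_eq] at hν1 ⊢
  rw [abs_le] at e1 e2 e3
  rw [abs_lt] at hν1 ⊢
  constructor <;> linarith

/-! ### Weak derivatives -/

/-- Integration by parts on the half-line: both boundary terms vanish because `ψ` has compact
support in `(0, ∞)`, and the bound on the derivative gives integrability. -/
theorem isWeakDeriv_deriv {f : ℝ → ℝ} (hf : Continuous f)
    (hd : ∀ t, 0 < t → DifferentiableAt ℝ f t) {L : ℝ} (hL : ∀ t, 0 < t → |deriv f t| ≤ L) :
    IsWeakDeriv f (deriv f) := by
  intro ψ hψ hcs hsupp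
  have hψc : Continuous ψ := hψ.continuous
  have hψ'c : Continuous (deriv ψ) := hψ.continuous_deriv (by simp)
  have hψ0 : ψ 0 = 0 := image_eq_zero_of_notMem_tsupport fun h => lt_irrefl (0 : ℝ) (hsupp h)
  have h1 := integral_Ioi_mul_deriv_eq_deriv_mul (u := f) (v := ψ) (u' := deriv f)
    (v' := deriv ψ) (a := 0) (a' := 0) (b' := 0) (fun t ht => (hd t ht).hasDerivAt)
    (fun t _ => (hψ.differentiable (by simp) t).hasDerivAt)
    ((hf.mul hψ'c).integrable_of_hasCompactSupport hcs.deriv.mul_left).integrableOn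
    ?_ ?_ ?_
  · simpa using h1
  · refine Integrable.bdd_mul (c := L)
      (hψc.integrable_of_hasCompactSupport hcs).integrableOn
      (measurable_deriv f).aestronglyMeasurable ?_
    filter_upwards [ae_restrict_mem measurableSet_Ioi] with t ht using hL t ht
  · have : Tendsto (f * ψ) (𝓝 0) (𝓝 ((f * ψ) 0)) := (hf.mul hψc).tendsto 0
    rw [Pi.mul_apply, hψ0, mul_zero] at this
    exact this.mono_left nhdsWithin_le_nhds
  · refine tendsto_const_nhds.congr' ?_
    have h2 : ψ =ᶠ[atTop] 0 := (hasCompactSupport_iff_eventuallyEq.1 hcs).filter_mono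
      (coclosedCompact_eq_cocompact (X := ℝ) ▸ atTop_le_cocompact)
    filter_upwards [h2] with t ht
    simp [ht]

theorem memLinftyLoc_of_bounded {f : ℝ → ℝ} (hf : Measurable f) {L : ℝ}
    (hL : ∀ t, 0 < t → |f t| ≤ L) : MemLinftyLoc f := fun _ _ =>
  memLp_top_of_bound hf.aestronglyMeasurable L
    ((ae_restrict_mem measurableSet_Ioo).mono fun t ht => hL t ht.1)

/-! ### The approximation scheme -/

theorem IsKernel.isBoundedAntisymm_truncR (hB : IsKernel B θ δ ρ C) (n : ℕ) :
    IsBoundedAntisymm (truncR B n) n :=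
  ⟨hB.measurable_truncR n, hB.truncR_antisymm n, hB.abs_truncR_le n⟩

theorem IsKernel.truncR_nonneg (hB : IsKernel B θ δ ρ C) (n : ℕ) {x y : ℝ≥0} (h : x ≤ y) :
    0 ≤ truncR B n x y := by
  refine mul_nonneg (le_min (hB.kernelb_nonneg _ _) n.cast_nonneg) (sub_nonneg.2 ?_)
  exact Real.exp_le_exp.2 (neg_le_neg h)

/-- The step length of the `n`-th Euler scheme, for measures of mass `M`. -/
def stepSize (M : ℝ≥0) (n : ℕ) : ℝ := 1 / ((n + 1) * (M + 1))

theorem stepSize_pos (M : ℝ≥0) (n : ℕ) : 0 < stepSize M n := by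
  unfold stepSize
  positivity

theorem stepSize_mul_le (M : ℝ≥0) (n : ℕ) : stepSize M n * (n * M) ≤ 1 := by
  rw [stepSize, one_div_mul_eq_div, div_le_one (by positivity)]
  have := M.2
  gcongr <;> linarith

theorem tendsto_stepSize (M : ℝ≥0) : Tendsto (stepSize M) atTop (𝓝 0) := by
  have := (tendsto_one_div_add_atTop_nhds_zero_nat (𝕜 := ℝ)).mul_const (1 / ((M : ℝ) + 1))
  rw [zero_mul] at this
  refine this.congr fun n => ?_
  rw [stepSize, one_div_mul_one_div]

/-- The `k`-th iterate of the Euler scheme for the kernel truncated at height `n`. -/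
def IsKernel.scheme (hB : IsKernel B θ δ ρ C) (u₀ : FiniteMeasure ℝ≥0) (n k : ℕ) :
    FiniteMeasure ℝ≥0 :=
  (eulerStep (hB.isBoundedAntisymm_truncR n) (stepSize_pos u₀.mass n).le)^[k] u₀

theorem IsKernel.scheme_succ (hB : IsKernel B θ δ ρ C) (u₀ : FiniteMeasure ℝ≥0) (n k : ℕ) :
    hB.scheme u₀ n (k + 1) = eulerStep (hB.isBoundedAntisymm_truncR n)
      (stepSize_pos u₀.mass n).le (hB.scheme u₀ n k) :=
  Function.iterate_succ_apply' _ _ _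

/-- Mass conservation is part of the induction: it keeps the fixed step length admissible at every
iterate. -/
theorem IsKernel.scheme_mem (hB : IsKernel B θ δ ρ C) (u₀ : FiniteMeasure ℝ≥0) {η : ℝ}
    (hη : 0 ≤ η) (n k : ℕ) :
    hB.scheme u₀ n k ∈ momentSet η u₀.mass (expMoment η u₀) := by
  induction k with
  | zero => exact ⟨rfl, le_rfl⟩
  | succ k ih =>
    rw [hB.scheme_succ]
    have hA : stepSize u₀.mass n * (n * (hB.scheme u₀ n k).mass) ≤ 1 := by
      rw [ih.1]
      exact stepSize_mul_le _ _
    exact ⟨((hB.isBoundedAntisymm_truncR n).mass_eulerStep _ hA).trans ih.1,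
      ((hB.isBoundedAntisymm_truncR n).expMoment_eulerStep_le _ hA
        (fun x y h => hB.truncR_nonneg n h) hη).trans ih.2⟩

theorem IsC1b.continuous_integral {φ : ℝ → ℝ} (hφ : IsC1b φ) :
    Continuous fun μ : FiniteMeasure ℝ≥0 => ∫ x : ℝ≥0, φ x ∂(μ : Measure ℝ≥0) := by
  obtain ⟨M, hM⟩ := hφ.bounded
  let f : ℝ≥0 →ᵇ ℝ := BoundedContinuousFunction.ofNormedAddCommGroup (fun x : ℝ≥0 => φ x)
    hφ.continuous_coe M fun x => hM x x.2
  exact continuous_iff_continuousAt.2 fun μ =>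
    FiniteMeasure.tendsto_iff_forall_integral_tendsto.1 tendsto_id f

end

end Compton

end

theorem theorem5p1 (B : ℝ≥0 → ℝ≥0 → ℝ) (θ δ ρ C : ℝ) (hB : Compton.IsKernel B θ δ ρ C)
    (u₀ : FiniteMeasure ℝ≥0) (η : ℝ) (hη : (1 - θ) / 2 < η)
    (hu₀ : Compton.expMoment η u₀ < ⊤) :
    ∃ u : ℝ≥0 → FiniteMeasure ℝ≥0,
      Continuous u ∧
      Compton.IsWeakSolution B u₀ u ∧
      (∀ t : ℝ≥0, (u t).mass = u₀.mass) ∧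
      (∀ t : ℝ≥0, Compton.expMoment η (u t) ≤ Compton.expMoment η u₀) := by
  have hη0 := hB.eta_pos hη
  -- One family serves twice: it separates measures in the compact set, and it consists of exactly
  -- the test functions of the weak equation.
  let ι := {φ : ℝ → ℝ // Compton.IsC1b φ ∧ derivWithin φ (Ici 0) 0 = 0}
  obtain ⟨u, hu, hu0, huK, hder⟩ := Compton.exists_limit_curve
    (Compton.isCompact_momentSet hη0 u₀.mass hu₀)
    (p := fun (φ : ι) μ => ∫ x : ℝ≥0, φ.1 x ∂(μ : Measure ℝ≥0))
    (fun φ => φ.2.1.continuous_integral)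
    (fun μ _ ν _ h => Compton.finiteMeasure_ext_of_isC1b fun φ hφ h0 => h ⟨φ, hφ, h0⟩)
    (v := hB.scheme u₀) (hB.scheme_mem u₀ hη0.le) (x₀ := u₀) (fun _ => rfl)
    (Compton.stepSize_pos u₀.mass) (Compton.tendsto_stepSize u₀.mass)
    (q := fun φ n => Compton.quadForm (Compton.truncIntegrand B n φ.1))
    (Q := fun φ => Compton.quadForm (Compton.collisionIntegrand B φ.1))
    (fun φ n k => by
      obtain ⟨M, hM⟩ := φ.2.1.bounded
      have hA : Compton.stepSize u₀.mass n * (n * (hB.scheme u₀ n k).mass) ≤ 1 := by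
        rw [(hB.scheme_mem u₀ hη0.le n k).1]
        exact Compton.stepSize_mul_le _ _
      rw [hB.scheme_succ, (hB.isBoundedAntisymm_truncR n).integral_eulerStep _ hA
        φ.2.1.continuous_coe.measurable (fun x => hM x x.2), add_sub_cancel_left]
      rfl)
    (fun φ => by
      obtain ⟨K, hK0, hK⟩ := hB.exists_abs_collisionIntegrand_le φ.2.1 hη
      exact ⟨_, fun n μ hμ => Compton.abs_quadForm_le hK0
        (fun p => (hB.abs_truncIntegrand_le n φ.1 p).trans (hK p)) hu₀ hμ⟩)
    (fun φ μ hμ => hB.tendsto_quadForm φ.2.1 φ.2.2 hη hu₀ hμ)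
  refine ⟨u, hu, ⟨fun φ => ?_, fun φ => by rw [hu0], fun φ hφ h0 => ?_, fun φ hφ h0 => ?_⟩,
    fun t => (huK t).1, fun t => (huK t).2⟩
  · exact continuous_iff_continuousAt.2 fun t =>
      FiniteMeasure.tendsto_iff_forall_integral_tendsto.1 (hu.tendsto t) φ
  · have hc : Continuous (Compton.pairing u φ) :=
      hφ.continuous_integral.comp (hu.comp continuous_real_toNNReal)
    have hd : ∀ t, 0 < t → HasDerivAt (Compton.pairing u φ)
        (Compton.quadForm (Compton.collisionIntegrand B φ) (u t.toNNReal)) t :=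
      hder ⟨φ, hφ, h0⟩
    obtain ⟨K, hK0, hK⟩ := hB.exists_abs_collisionIntegrand_le hφ hη
    have hL : ∀ t, 0 < t → |deriv (Compton.pairing u φ) t| ≤
        K * (u₀.mass * (Compton.expMoment η u₀).toReal) := fun t ht => by
      rw [(hd t ht).deriv]
      exact Compton.abs_quadForm_le hK0 hK hu₀ (huK _)
    obtain ⟨M, hM⟩ := hφ.bounded
    refine ⟨Compton.memLinftyLoc_of_bounded hc.measurable (L := M * u₀.mass) fun t _ => ?_,
      deriv (Compton.pairing u φ), Compton.memLinftyLoc_of_bounded (measurable_deriv _) hL,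
      Compton.isWeakDeriv_deriv hc (fun t ht => (hd t ht).differentiableAt) hL⟩
    rw [← (huK t.toNNReal).1]
    exact norm_integral_le_of_norm_le_const (f := fun x : ℝ≥0 => φ x)
      (ae_of_all _ fun x => hM x x.2)
  -- The equation in fact holds at every `t > 0`, with no exceptional null set.
  · filter_upwards [ae_restrict_mem measurableSet_Ioi] with t ht
    exact ⟨hB.integrable_collisionIntegrand hφ h0 hη ((huK _).2.trans_lt hu₀),
      hder ⟨φ, hφ, h0⟩ t ht⟩
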